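/- Let $(X,\Sigma,\mu)$ be a $\sigma$-finite measure space with $\mu(X)=1$ or $\mu(X)=\infty$, whose measure is diffuse: every $A\in\Sigma$ with $0<\mu(A)<\infty$ contains a measurable $B$ with $\mu(B)=\mu(A)/2$. For measurable $f:X\to\mathbb R$ and $p\ge 1$ put $|f|_p=\left(\int_X|f|^p\,d\mu\right)^{1/p}$. Let $1\le a<b\le\infty$. Let $U\Psi(a,b)$ be the set of positive continuous functions on $(a,b)$, let $\Psi(a,b)$ be the set of those $\psi\in U\Psi(a,b)$ for which there is a measurable $f:X\to\mathbb R$ with $\psi(p)=|f|_p$ for all $p\in(a,b)$, and let $EX\Psi(a,b)$ be the set of functions $\nu$ on $(a,b)$ with $\nu\asymp\psi$ for some $\psi\in\Psi(a,b)$; here $\asymp$ denotes two-sided estimates on $(a,b)$ with positive finite constants. For a positive function $\psi$ on $(a,b)$ the space $G(\psi)$ consists of the measurable $f$ with $$\|f\|_{G(\psi)}=\sup_{p\in(a,b)}\frac{|f|_p}{\psi(p)}<\infty ,$$ and its fundamental function is $\varphi(\delta)=\sup_{p\in(a,b)}\delta^{1/p}/\psi(p)$, $\delta>0$. Let $f^*(t)=\inf\{s\ge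 0:\mu\{|f|>s\}\le t\}$. Two spaces of measurable functions on $X$ are called equivalent if they have the same elements and their (quasi-)norms are comparable up to positive constants. **A.** Let $\psi\in EX\Psi(a,b)$, let $g:X\to\mathbb R$ be measurable with $\psi(p)\asymp|g|_p$ on $(a,b)$, and let $N(u)=\sup\{1/\delta:\ \delta>0,\ 1/\varphi(\delta)\le u\}$, $u\ge 0$, be the generalized inverse of $1/\delta\mapsto 1/\varphi(\delta)$. If $$\int_X N(\varepsilon|g(x)|)\,\mu(dx)=\infty\qquad\text{for all }\varepsilon>0, \tag{2.1}$$ then $G(\psi)$ is not equivalent to any Orlicz space $Or(X,\mu,\Phi)$ with its Luxemburg norm $\inf\{k>0:\int_X\Phi(|f|/k)\,d\mu\le 1\}$, where $\Phi:[0,\infty)\to[0,\infty]$ is convex, $\Phi(0)=0$, $\Phi(u)\to\infty$ as $u\to\infty$, and $\Phi(u)<\infty$ for some $u>0$. **B.** Let $\psi\in U\Psi(a,b)\cup EX\Psi(a,b)$ and let $T(x)=\sup\{\delta:\ 0<\delta<\infty,\ \delta\le\mu(X),\ 1/\varphi(\delta)>x\}$, $x>0$ (with $\sup\emptyset=0$),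 be the inverse function of $1/\varphi$ on the set of values of $\mu$. If $$\sup_{p\in(a,b)}\ \frac{1}{\psi(p)}\left(\int_0^\infty x^{p-1}T(x)\,dx\right)^{1/p}=\infty, \tag{2.2}$$ then $G(\psi)$ is not equivalent to any Marcinkiewicz space $M(\theta)$ with $\|f\|_{M(\theta)}=\sup_{\delta>0}\theta(\delta)f^*(\delta)$, $\theta:(0,\infty)\to(0,\infty)$. If moreover $a>1$ or $b<\infty$ or $\mu(X)=1$, then $G(\psi)$ is also not equivalent to any Marcinkiewicz space in the integral form $\sup_{h>0}\theta(h)^{-1}\int_0^h f^*(s)\,ds$ with $\theta$ quasi-concave, as defined in C. **C.** Let $1\le a<b<\infty$ and let $\psi\in U\Psi(a,b)$ satisfy $\psi(a+0)=\infty$ or $\psi(b-0)=\infty$. Then $G(\psi)$ is not equivalent to any Lorentz space $L(\chi)$ with $\|f\|_{L(\chi)}=\int_{[0,\infty)}f^*(t)\,d\chi(t)$, where $\chi$ is quasi-concave: $\chi(0)=0$, $\chi>0$ and nondecreasing on $(0,\infty)$, and $\chi(t)/t$ nonincreasing (a jump of $\chi$ at $0$ contributes $\chi(0+)f^*(0)$).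 -/

import Mathlib

open MeasureTheory Set Filter Topology
open scoped ENNReal NNReal

noncomputable section

/-! ### Diffuse measures and the classes of generating functions -/

/-- A measure is diffuse if every measurable set of positive finite measure contains
a measurable subset of half the measure. -/
def IsDiffuse {X : Type*} [MeasurableSpace X] (μ : Measure X) : Prop :=
  ∀ A : Set X, MeasurableSet A → 0 < μ A → μ A < ∞ →
    ∃ B : Set X, B ⊆ A ∧ MeasurableSet B ∧ μ B = μ A / 2

/-- The open interval `(a, b)` of real exponents, where `b` may be `∞`. -/
def expInterval (a : ℝ) (b : EReal) : Set ℝ := {p : ℝ | a < p ∧ (p : EReal) < b}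

/-- The class `Ψ(a,b)`: the positive continuous functions on `(a,b)` of the form `p ↦ |f|_p`.
Here `|f|_p = (∫ |f|^p dμ)^(1/p)` is `eLpNorm' f p μ`. -/
def PsiClass {X : Type*} [MeasurableSpace X] (μ : Measure X) (a : ℝ) (b : EReal) :
    Set (ℝ → ℝ) :=
  {ψ | (∀ p ∈ expInterval a b, 0 < ψ p) ∧ ContinuousOn ψ (expInterval a b) ∧
    ∃ f : X → ℝ, Measurable f ∧
      ∀ p ∈ expInterval a b, eLpNorm' f p μ = ENNReal.ofReal (ψ p)}

/-- The class `EXΨ(a,b)`: the functions `ν` on `(a,b)` which are comparable, up to positive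
constants, to an element of `Ψ(a,b)`. -/
def EXPsiClass {X : Type*} [MeasurableSpace X] (μ : Measure X) (a : ℝ) (b : EReal) :
    Set (ℝ → ℝ) :=
  {ν | ∃ ψ ∈ PsiClass μ a b, ∃ c C : ℝ, 0 < c ∧ 0 < C ∧
    ∀ p ∈ expInterval a b, c * ψ p ≤ ν p ∧ ν p ≤ C * ψ p}

/-- The class `UΨ(a,b)`: all positive continuous functions on `(a,b)`. -/
def UPsiClass (a : ℝ) (b : EReal) : Set (ℝ → ℝ) :=
  {ψ | (∀ p ∈ expInterval a b, 0 < ψ p) ∧ ContinuousOn ψ (expInterval a b)}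

/-- `ψ(p) ≍ |g|_p` on `(a,b)`: two-sided estimates with positive finite constants. -/
def ComparableToMoments {X : Type*} [MeasurableSpace X] (μ : Measure X) (a : ℝ) (b : EReal)
    (ψ : ℝ → ℝ) (g : X → ℝ) : Prop :=
  ∃ c C : ℝ≥0, 0 < c ∧ 0 < C ∧ ∀ p ∈ expInterval a b,
    (c : ℝ≥0∞) * eLpNorm' g p μ ≤ ENNReal.ofReal (ψ p) ∧
      ENNReal.ofReal (ψ p) ≤ (C : ℝ≥0∞) * eLpNorm' g p μ

/-! ### The moment space `G(ψ)` and its fundamental function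

All the function spaces below consist of the measurable functions `f : X → ℝ` at which the
extended-valued functional is finite. -/

/-- The norm of `G(ψ)`: the supremum of `|f|_p / ψ(p)` over `p ∈ (a,b)`. -/
def gNorm {X : Type*} [MeasurableSpace X] (μ : Measure X) (a : ℝ) (b : EReal) (ψ : ℝ → ℝ)
    (f : X → ℝ) : ℝ≥0∞ :=
  ⨆ p ∈ expInterval a b, eLpNorm' f p μ / ENNReal.ofReal (ψ p)

/-- The fundamental function of `G(ψ)`: the supremum of `δ^(1/p) / ψ(p)` over `p ∈ (a,b)`.
It is the norm in `G(ψ)` of the indicator function of any set of measure `δ`. -/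
def gFund (a : ℝ) (b : EReal) (ψ : ℝ → ℝ) (δ : ℝ) : ℝ≥0∞ :=
  ⨆ p ∈ expInterval a b, ENNReal.ofReal δ ^ (1 / p) / ENNReal.ofReal (ψ p)

/-- The function `N` on `[0,∞)` whose generalized inverse is `1/δ ↦ 1/φ(δ)`, `δ ∈ (0,∞)`, where
`φ` is the fundamental function of `G(ψ)`: `N(u)` is the supremum of the numbers `t = 1/δ` with
`1/φ(δ) ≤ u`. -/
def gOrliczFun (a : ℝ) (b : EReal) (ψ : ℝ → ℝ) (u : ℝ≥0) : ℝ≥0∞ :=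
  ⨆ δ ∈ {δ : ℝ | 0 < δ ∧ (gFund a b ψ δ)⁻¹ ≤ (u : ℝ≥0∞)}, ENNReal.ofReal (1 / δ)

/-- The function `T` inverse to the nonincreasing function `δ ↦ 1/φ(δ)`, where `φ` is the
fundamental function of `G(ψ)` and `δ` runs over the positive finite numbers up to `μ(X)`
(the values of the measure): `T(x)` is the supremum of the `δ` with `1/φ(δ) > x`. -/
def gTail {X : Type*} [MeasurableSpace X] (μ : Measure X) (a : ℝ) (b : EReal) (ψ : ℝ → ℝ)
    (x : ℝ) : ℝ≥0∞ :=
  ⨆ δ ∈ {δ : ℝ | 0 < δ ∧ ENNReal.ofReal δ ≤ μ univ ∧ ENNReal.ofReal x < (gFund a b ψ δ)⁻¹},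
    ENNReal.ofReal δ

/-! ### Orlicz, Marcinkiewicz and Lorentz spaces -/

/-- Orlicz (Young) functions: convex, zero at zero, tending to infinity, and finite somewhere
off zero; the value `∞` is allowed. Such a function is extended evenly to the real line. -/
structure IsOrliczFun (Φ : ℝ≥0 → ℝ≥0∞) : Prop where
  convex : ∀ u v s t : ℝ≥0, s + t = 1 → Φ (s * u + t * v) ≤ s * Φ u + t * Φ v
  zero : Φ 0 = 0
  tendsto : Tendsto Φ atTop (𝓝 ∞)
  finite : ∃ u : ℝ≥0, 0 < u ∧ Φ u < ∞

/-- The Luxemburg norm of the Orlicz space `Or(X, μ, Φ)`: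
the infimum of the `k > 0` with `∫ Φ(|f|/k) dμ ≤ 1`. -/
def orliczNorm {X : Type*} [MeasurableSpace X] (μ : Measure X) (Φ : ℝ≥0 → ℝ≥0∞)
    (f : X → ℝ) : ℝ≥0∞ :=
  ⨅ k ∈ {k : ℝ≥0 | 0 < k ∧ ∫⁻ x, Φ (‖f x‖₊ / k) ∂μ ≤ 1}, (k : ℝ≥0∞)

/-- The nonincreasing rearrangement, that is, the generalized inverse of the tail function:
`f^*(t)` is the infimum of the `s ≥ 0` with `μ {|f| > s} ≤ t`. -/
def rearr {X : Type*} [MeasurableSpace X] (μ : Measure X) (f : X → ℝ) (t : ℝ) : ℝ≥0∞ :=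
  sInf {s : ℝ≥0∞ | μ {x | s < ‖f x‖ₑ} ≤ ENNReal.ofReal t}

/-- The Marcinkiewicz functional: the supremum of `θ(δ) f^*(δ)` over `δ > 0`. -/
def marcNorm {X : Type*} [MeasurableSpace X] (μ : Measure X) (θ : ℝ → ℝ) (f : X → ℝ) : ℝ≥0∞ :=
  ⨆ δ ∈ Ioi (0 : ℝ), ENNReal.ofReal (θ δ) * rearr μ f δ

/-- The Marcinkiewicz norm in integral form:
the supremum of `(1/θ(h)) ∫_0^h f^*(s) ds` over `h > 0`. -/
def marcIntNorm {X : Type*} [MeasurableSpace X] (μ : Measure X) (θ : ℝ → ℝ) (f : X → ℝ) :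
    ℝ≥0∞ :=
  ⨆ h ∈ Ioi (0 : ℝ), (∫⁻ s in Ioo 0 h, rearr μ f s) / ENNReal.ofReal (θ h)

/-- Quasi-concave functions on `[0,∞)`, extended by zero to the negative half-line: positive and
nondecreasing on `(0,∞)`, zero at zero, and `χ(t)/t` nonincreasing. Every nonzero nondecreasing
concave function on `[0,∞)` which vanishes at zero is of this kind. -/
structure IsQuasiConcave (χ : ℝ → ℝ) : Prop where
  zero : ∀ t ≤ 0, χ t = 0
  pos : ∀ t, 0 < t → 0 < χ t
  mono : Monotone χ
  anti : AntitoneOn (fun t => χ t / t) (Ioi 0)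

/-- The norm of the Lorentz space `L(χ)`: the Stieltjes integral of `f^*` against `dχ` over
`[0,∞)`; a jump of `χ` at zero contributes `χ(0+) f^*(0)`. -/
def lorentzNorm {X : Type*} [MeasurableSpace X] (μ : Measure X) (χ : ℝ → ℝ) (hχ : Monotone χ)
    (f : X → ℝ) : ℝ≥0∞ :=
  ∫⁻ t in Ici (0 : ℝ), rearr μ f t ∂hχ.stieltjesFunction.measure

/-- Equivalence of two spaces of measurable functions on `X` given by extended-valued
functionals: they have the same elements, and the functionals are comparable up to a constant. -/
def EquivSpaces {X : Type*} [MeasurableSpace X] (A B : (X → ℝ) → ℝ≥0∞) : Prop :=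
  (∀ f : X → ℝ, Measurable f → (A f < ∞ ↔ B f < ∞)) ∧
    ∃ C : ℝ≥0, ∀ f : X → ℝ, Measurable f → A f ≤ C * B f ∧ B f ≤ C * A f

end

/-! Each equivalence is refuted by the same device. On the indicator of a set of measure `δ` the
`G(ψ)` norm is `φ(δ)`, and diffuseness supplies sets of every measure up to `μ(X)`; so an
equivalence makes the indicator norms of the competing space comparable to `φ`. A function is then
exhibited (or given) that separates the two norms.

Orlicz: comparability on indicators gives `N(u) ≤ Φ(2Cu) + 1/μ(X)` (`gOrliczFun_le`). Since `g` lies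
in `G(ψ)`, it would lie in the Orlicz space, and `∫ N(ε|g|)` would be finite for some `ε`, against
(2.1).

Marcinkiewicz: diffuseness gives a function whose rearrangement is, up to constants, `1/φ`
(`IsDiffuse.exists_tailUpTo`). It belongs to `M(θ)` because `θ ≲ φ`, while the layer-cake formula
and (2.2) put it outside `G(ψ)`. For the integral form one also needs `∫_0^h ds/φ(s) ≲ h/φ(h)`,
which follows from power growth of `φ` with an exponent `1/q < 1`. This holds globally if `a > 1`,
and on `(0,1]` always; if `b < ∞` the part on `(0,1]` suffices, by
`gNorm_eq_top_of_tailUpTo_one_le`.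

Lorentz: the norm is nearly additive over indicators of rapidly shrinking sets, whereas `G(ψ)` only
sees `p`-th power sums. With heights `1/((k+1)φ(δ_k))` the first sum is harmonic and diverges, the
second converges uniformly in `p`. -/

theorem exists_seq_of_step {α : Type*} {P : ℕ → α → Prop} {R : ℕ → α → α → Prop}
    (h0 : ∃ a, P 0 a) (hs : ∀ n a, P n a → ∃ b, P (n + 1) b ∧ R n a b) :
    ∃ u : ℕ → α, ∀ n, P n (u n) ∧ R n (u n) (u (n + 1)) := by
  classical
  obtain ⟨a, ha⟩ := h0
  choose! F hF hR using hs
  let u : ℕ → α := fun n => Nat.rec a (fun n x => F n x) n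
  have hu : ∀ n, P n (u n) := by
    intro n
    induction n with
    | zero => exact ha
    | succ n ih => exact hF n _ ih
  exact ⟨u, fun n => ⟨hu n, hR n _ (hu n)⟩⟩

/-! ### Sets of prescribed measure and functions with prescribed tails. -/

section Diffuse

variable {X : Type*} [MeasurableSpace X] {μ : Measure X}

theorem IsDiffuse.exists_half (hd : IsDiffuse μ) {A : Set X} (hA : MeasurableSet A)
    (hfin : μ A < ∞) : ∃ B ⊆ A, MeasurableSet B ∧ μ B = μ A / 2 := by
  rcases eq_or_ne (μ A) 0 with h | h
  · exact ⟨∅, empty_subset _, MeasurableSet.empty, by simp [h]⟩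
  · exact hd A hA (pos_iff_ne_zero.2 h) hfin

/-- Bisection: `L` is the part already accepted and `D` a disjoint reserve of measure `μ(A)/2^n`,
with `t` always between `μ(L)` and `μ(L) + μ(D)`. Half of `D` is added to `L` whenever this does not
exceed `t`; the union of the sets `L` has measure `t`. -/
theorem IsDiffuse.exists_subset_of_lt_top (hd : IsDiffuse μ) {A : Set X} (hA : MeasurableSet A)
    (hfin : μ A < ∞) {t : ℝ≥0∞} (ht : t ≤ μ A) : ∃ B ⊆ A, MeasurableSet B ∧ μ B = t := by
  let P : ℕ → Set X × Set X → Prop := fun n s =>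
    MeasurableSet s.1 ∧ MeasurableSet s.2 ∧ s.1 ⊆ A ∧ s.2 ⊆ A ∧ Disjoint s.1 s.2 ∧
      μ s.1 ≤ t ∧ t ≤ μ s.1 + μ s.2 ∧ μ s.2 = μ A * 2⁻¹ ^ n
  obtain ⟨u, hu⟩ : ∃ u : ℕ → Set X × Set X, ∀ n, P n (u n) ∧ (u n).1 ⊆ (u (n + 1)).1 := by
    refine exists_seq_of_step (R := fun _ s s' => s.1 ⊆ s'.1) (P := P) ⟨(∅, A), ?_⟩ ?_
    · simp [P, hA, ht]
    · rintro n ⟨L, D⟩ ⟨hL, hD, hLA, hDA, hdis, h1, h2, h3⟩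
      simp only at hL hD hLA hDA hdis h1 h2 h3
      have hDfin : μ D < ∞ := (measure_mono hDA).trans_lt hfin
      obtain ⟨B, hBD, hB, hBm⟩ := hd.exists_half hD hDfin
      have hpow : μ B = μ A * 2⁻¹ ^ (n + 1) := by
        rw [hBm, h3, pow_succ, ← mul_assoc, ENNReal.div_eq_inv_mul, mul_comm]
      have hadd : μ B + μ (D \ B) = μ D := by
        rw [measure_add_sdiff hB.nullMeasurableSet, union_eq_self_of_subset_left hBD]
      have hdiff : μ (D \ B) = μ B := by
        have : μ B + μ (D \ B) = μ B + μ B := by rw [hadd, hBm, ENNReal.add_halves]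
        exact (ENNReal.add_right_inj ((measure_mono hBD).trans_lt hDfin).ne).1 this
      have hLB : μ (L ∪ B) = μ L + μ B := measure_union (hdis.mono_right hBD) hB
      by_cases hc : μ L + μ B ≤ t
      · refine ⟨(L ∪ B, D \ B), ⟨hL.union hB, hD.diff hB, union_subset hLA (hBD.trans hDA),
          sdiff_subset.trans hDA, ?_, ?_, ?_, ?_⟩, subset_union_left⟩
        · exact Disjoint.union_left (hdis.mono_right sdiff_subset) disjoint_sdiff_self_right
        · simpa only [hLB] using hc
        · simp only [hLB]; rwa [add_assoc, hadd]
        · simp only [hdiff, hpow]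
      · exact ⟨(L, B), ⟨hL, hB, hLA, hBD.trans hDA, hdis.mono_right hBD, h1, (not_le.1 hc).le,
          hpow⟩, Subset.rfl⟩
  have hmono : Monotone fun n => (u n).1 := monotone_nat_of_le_succ fun n => (hu n).2
  refine ⟨⋃ n, (u n).1, iUnion_subset fun n => (hu n).1.2.2.1,
    MeasurableSet.iUnion fun n => (hu n).1.1, ?_⟩
  rw [hmono.measure_iUnion]
  refine le_antisymm (iSup_le fun n => (hu n).1.2.2.2.2.2.1) ?_
  have hlim : Tendsto (fun n : ℕ => (⨆ n, μ (u n).1) + μ A * 2⁻¹ ^ n) atTop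
      (𝓝 ((⨆ n, μ (u n).1) + μ A * 0)) := by
    refine tendsto_const_nhds.add (ENNReal.Tendsto.const_mul ?_ (Or.inr hfin.ne))
    exact ENNReal.tendsto_pow_atTop_nhds_zero_of_lt_one (by simp)
  rw [mul_zero, add_zero] at hlim
  refine ge_of_tendsto' hlim fun n => ?_
  obtain ⟨-, -, -, -, -, -, h2, h3⟩ := (hu n).1
  rw [← h3]
  exact h2.trans (add_le_add (le_iSup (fun n => μ (u n).1) n) le_rfl)

theorem IsDiffuse.exists_subset [SigmaFinite μ] (hd : IsDiffuse μ) {A : Set X}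
    (hA : MeasurableSet A) {t : ℝ≥0∞} (ht : t ≤ μ A) :
    ∃ B ⊆ A, MeasurableSet B ∧ μ B = t := by
  rcases ht.eq_or_lt with h | h
  · exact ⟨A, Subset.rfl, hA, h.symm⟩
  · obtain ⟨C, hC, hCA, htC, hCfin⟩ := μ.exists_subset_measure_lt_top hA h
    obtain ⟨B, hB, hBm, hBt⟩ := hd.exists_subset_of_lt_top hC hCfin htC.le
    exact ⟨B, hB.trans hCA, hBm, hBt⟩

theorem IsDiffuse.exists_superset [SigmaFinite μ] (hd : IsDiffuse μ) {A : Set X}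
    (hA : MeasurableSet A) {t : ℝ≥0∞} (hfin : t ≠ ∞) (hAt : μ A ≤ t) (ht : t ≤ μ univ) :
    ∃ B, A ⊆ B ∧ MeasurableSet B ∧ μ B = t := by
  have hAfin : μ A ≠ ∞ := (hAt.trans_lt hfin.lt_top).ne
  have h : t - μ A ≤ μ Aᶜ := by
    rw [measure_compl hA hAfin]
    exact tsub_le_tsub_right ht _
  obtain ⟨B, hB, hBm, hBt⟩ := hd.exists_subset hA.compl h
  refine ⟨A ∪ B, subset_union_left, hA.union hBm, ?_⟩
  rw [measure_union ((disjoint_compl_right).mono_right hB) hBm, hBt, add_tsub_cancel_of_le hAt]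

/-- Two chains start from one set of measure `t 0`: subsets are chosen successively for positive
indices, supersets for negative ones, and the chains are glued at `0`. -/
theorem IsDiffuse.exists_antitone_family [SigmaFinite μ] (hd : IsDiffuse μ) {t : ℤ → ℝ≥0∞}
    (ht : Antitone t) (hfin : ∀ k, t k ≠ ∞) (hle : ∀ k, t k ≤ μ univ) :
    ∃ E : ℤ → Set X, Antitone E ∧ ∀ k, MeasurableSet (E k) ∧ μ (E k) = t k := by
  obtain ⟨E₀, -, hE₀, hE₀t⟩ := hd.exists_subset MeasurableSet.univ (hle 0)
  obtain ⟨D, hD⟩ : ∃ D : ℕ → Set X, ∀ n, (MeasurableSet (D n) ∧ μ (D n) = t n ∧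
      (n = 0 → D n = E₀)) ∧ D (n + 1) ⊆ D n := by
    refine exists_seq_of_step (P := fun n A => MeasurableSet A ∧ μ A = t n ∧ (n = 0 → A = E₀))
      (R := fun _ A B => B ⊆ A) ⟨E₀, hE₀, by simpa using hE₀t, fun _ => rfl⟩ ?_
    rintro n A ⟨hA, hAt, -⟩
    obtain ⟨B, hB, hBm, hBt⟩ := hd.exists_subset hA (t := t ((n + 1 : ℕ) : ℤ))
      (by rw [hAt]; exact ht (by push_cast; linarith))
    exact ⟨B, ⟨hBm, hBt, by simp⟩, hB⟩
  obtain ⟨U, hU⟩ : ∃ U : ℕ → Set X, ∀ n, (MeasurableSet (U n) ∧ μ (U n) = t (-n) ∧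
      (n = 0 → U n = E₀)) ∧ U n ⊆ U (n + 1) := by
    refine exists_seq_of_step
      (P := fun n A => MeasurableSet A ∧ μ A = t (-n) ∧ (n = 0 → A = E₀))
      (R := fun _ A B => A ⊆ B) ⟨E₀, hE₀, by simpa using hE₀t, fun _ => rfl⟩ ?_
    rintro n A ⟨hA, hAt, -⟩
    obtain ⟨B, hB, hBm, hBt⟩ := hd.exists_superset hA (t := t (-((n + 1 : ℕ) : ℤ))) (hfin _)
      (by rw [hAt]; exact ht (by push_cast; linarith)) (hle _)
    exact ⟨B, ⟨hBm, hBt, by simp⟩, hB⟩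
  refine ⟨fun k => if 0 ≤ k then D k.toNat else U (-k).toNat, antitone_int_of_succ_le ?_, ?_⟩
  · intro k
    rcases lt_trichotomy k (-1) with h | h | h
    · have h1 : ¬ 0 ≤ k := by omega
      have h2 : ¬ 0 ≤ k + 1 := by omega
      have h3 : (-k).toNat = (-(k + 1)).toNat + 1 := by omega
      simp only [h1, h2, if_false, h3]
      exact (hU _).2
    · subst h
      have h0 := (hU 0).2
      rw [(hU 0).1.2.2 rfl, ← (hD 0).1.2.2 rfl] at h0
      simpa using h0
    · have h1 : 0 ≤ k := by omega
      have h2 : 0 ≤ k + 1 := by omega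
      have h3 : (k + 1).toNat = k.toNat + 1 := by omega
      simp only [h1, h2, if_true, h3]
      exact (hD _).2
  · intro k
    by_cases h : 0 ≤ k
    · simp only [h, if_true]
      refine ⟨(hD _).1.1, ?_⟩
      rw [(hD _).1.2.1, Int.toNat_of_nonneg h]
    · simp only [h, if_false]
      refine ⟨(hU _).1.1, ?_⟩
      rw [(hU _).1.2.1, Int.toNat_of_nonneg (by omega), neg_neg]

/-- Up to a factor `2` in the argument, every nonincreasing function vanishing at infinity
is the tail function of some measurable function. -/
theorem IsDiffuse.exists_tail [SigmaFinite μ] (hd : IsDiffuse μ) {T : ℝ → ℝ≥0∞}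
    (hT : Antitone T) (hfin : ∀ x, 0 < x → T x ≠ ∞) (hle : ∀ x, T x ≤ μ univ)
    (hlim : ∀ ε : ℝ≥0∞, 0 < ε → ∃ x, T x ≤ ε) :
    ∃ f : X → ℝ, Measurable f ∧ ∀ x, 0 < x →
      T x ≤ μ {y | ENNReal.ofReal x < ‖f y‖ₑ} ∧
        μ {y | ENNReal.ofReal x < ‖f y‖ₑ} ≤ T (x / 2) := by
  have hz : ∀ k : ℤ, (0 : ℝ) < 2 ^ k := fun k => by positivity
  -- Dyadic levels: `F = sup_k 2^k 1_{E_k}` with `μ(E_k) = T(2^(k-1))`. For `2^k ≤ x < 2^(k+1)` the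
  -- set `{F > x}` is `E_{k+1}`, of measure `T(2^k)`, which lies between `T(x)` and `T(x/2)`.
  obtain ⟨E, hE, hEm⟩ := hd.exists_antitone_family (t := fun k : ℤ => T (2 ^ (k - 1)))
    (fun j k h => hT (zpow_le_zpow_right₀ one_le_two (by omega))) (fun k => hfin _ (hz _))
    (fun k => hle _)
  let F : X → ℝ≥0∞ := fun y => ⨆ k : ℤ, (E k).indicator (fun _ => ENNReal.ofReal (2 ^ k)) y
  have hF : Measurable F := .iSup fun k => measurable_const.indicator (hEm k).1
  have hlt : ∀ (x : ℝ) (k : ℤ), 2 ^ k ≤ x → x < 2 ^ (k + 1) →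
      {y | ENNReal.ofReal x < F y} = E (k + 1) := by
    intro x k h1 h2
    ext y
    simp only [F, mem_ofPred_eq, lt_iSup_iff]
    constructor
    · rintro ⟨j, hj⟩
      by_cases hy : y ∈ E j
      · rw [indicator_of_mem hy] at hj
        have h3 : x < 2 ^ j := (ENNReal.ofReal_lt_ofReal_iff (hz j)).1 hj
        have : k < j := (zpow_lt_zpow_iff_right₀ one_lt_two).1 (h1.trans_lt h3)
        exact hE (by omega) hy
      · simp [indicator_of_notMem hy] at hj
    · intro hy
      refine ⟨k + 1, ?_⟩
      rw [indicator_of_mem hy]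
      exact (ENNReal.ofReal_lt_ofReal_iff (hz _)).2 h2
  have htail : ∀ x : ℝ, 0 < x → T x ≤ μ {y | ENNReal.ofReal x < F y} ∧
      μ {y | ENNReal.ofReal x < F y} ≤ T (x / 2) := by
    intro x hx
    obtain ⟨k, h1, h2⟩ := exists_mem_Ico_zpow hx (one_lt_two (α := ℝ))
    rw [hlt x k h1 h2, (hEm _).2]
    simp only [add_sub_cancel_right]
    refine ⟨hT h1, hT ?_⟩
    rw [zpow_add_one₀ two_ne_zero] at h2
    linarith
  -- The tail tends to zero, so passing to real values changes `F` only on a null set.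
  have hae : ∀ᵐ y ∂μ, F y ≠ ∞ := by
    rw [ae_iff]
    simp only [ne_eq, not_not]
    refine le_antisymm (le_of_forall_pos_le_add fun ε hε => ?_) (zero_le)
    obtain ⟨x, hx⟩ := hlim ε hε
    rw [zero_add]
    have hpos : 0 < 2 * max x 1 := by positivity
    calc μ {y | F y = ∞} ≤ μ {y | ENNReal.ofReal (2 * max x 1) < F y} :=
          measure_mono fun y hy => by
            simp only [mem_ofPred_eq] at hy ⊢
            rw [hy]; exact ENNReal.ofReal_lt_top
      _ ≤ T (2 * max x 1 / 2) := (htail _ hpos).2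
      _ ≤ T x := hT (by rw [mul_div_cancel_left₀ _ two_ne_zero]; exact le_max_left _ _)
      _ ≤ ε := hx
  refine ⟨fun y => (F y).toReal, hF.ennreal_toReal, fun x hx => ?_⟩
  have : μ {y | ENNReal.ofReal x < ‖(F y).toReal‖ₑ} = μ {y | ENNReal.ofReal x < F y} := by
    refine measure_congr (Filter.eventuallyEq_set.2 ?_)
    filter_upwards [hae] with y hy
    rw [Real.enorm_eq_ofReal ENNReal.toReal_nonneg, ENNReal.ofReal_toReal hy]
  rw [this]
  exact htail x hx

end Diffuse

/-! ### Elementary properties of the fundamental function. -/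

section Fundamental

variable {a : ℝ} {b : EReal} {ψ : ℝ → ℝ}

theorem exists_mem_expInterval (hab : (a : EReal) < b) : ∃ p, p ∈ expInterval a b := by
  obtain ⟨p, h1, h2⟩ := EReal.lt_iff_exists_real_btwn.1 hab
  exact ⟨p, EReal.coe_lt_coe_iff.1 h1, h2⟩

theorem exists_gt_mem_expInterval {p : ℝ} (hp : p ∈ expInterval a b) :
    ∃ q ∈ expInterval a b, p < q := by
  obtain ⟨q, h1, h2⟩ := EReal.lt_iff_exists_real_btwn.1 hp.2
  have := EReal.coe_lt_coe_iff.1 h1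
  exact ⟨q, ⟨hp.1.trans this, h2⟩, this⟩

theorem ofReal_rpow_div_ofReal {δ p : ℝ} (hδ : 0 < δ) (hp : 0 < ψ p) :
    ENNReal.ofReal δ ^ (1 / p) / ENNReal.ofReal (ψ p) = ENNReal.ofReal (δ ^ (1 / p) / ψ p) := by
  rw [ENNReal.ofReal_div_of_pos hp, ENNReal.ofReal_rpow_of_pos hδ]

theorem le_gFund (hψ : ∀ p ∈ expInterval a b, 0 < ψ p) {δ p : ℝ} (hδ : 0 < δ)
    (hp : p ∈ expInterval a b) : ENNReal.ofReal (δ ^ (1 / p) / ψ p) ≤ gFund a b ψ δ := by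
  rw [← ofReal_rpow_div_ofReal hδ (hψ p hp)]
  exact le_iSup₂_of_le p hp le_rfl

theorem gFund_le (hψ : ∀ p ∈ expInterval a b, 0 < ψ p) {δ : ℝ} (hδ : 0 < δ) {M : ℝ≥0∞}
    (h : ∀ p ∈ expInterval a b, ENNReal.ofReal (δ ^ (1 / p) / ψ p) ≤ M) :
    gFund a b ψ δ ≤ M :=
  iSup₂_le fun p hp => by
    rw [ofReal_rpow_div_ofReal hδ (hψ p hp)]
    exact h p hp

theorem gFund_mono (ha : 1 ≤ a) : Monotone (gFund a b ψ) := fun δ δ' h =>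
  iSup₂_mono fun p hp => by
    have : 0 ≤ 1 / p := one_div_nonneg.2 (by linarith [hp.1])
    gcongr

theorem gFund_pos (hab : (a : EReal) < b) (hψ : ∀ p ∈ expInterval a b, 0 < ψ p)
    {δ : ℝ} (hδ : 0 < δ) : 0 < gFund a b ψ δ := by
  obtain ⟨p, hp⟩ := exists_mem_expInterval hab
  refine lt_of_lt_of_le ?_ (le_gFund hψ hδ hp)
  have := hψ p hp
  rw [ENNReal.ofReal_pos]
  positivity

theorem gFund_le_mul (hψ : ∀ p ∈ expInterval a b, 0 < ψ p) {δ δ' c : ℝ} (hδ : 0 < δ)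
    (hδ' : 0 < δ') (hc : 0 ≤ c) (h : ∀ p ∈ expInterval a b, δ ^ (1 / p) ≤ c * δ' ^ (1 / p)) :
    gFund a b ψ δ ≤ ENNReal.ofReal c * gFund a b ψ δ' := by
  refine gFund_le hψ hδ fun p hp => ?_
  refine le_trans ?_ (mul_le_mul_right (le_gFund hψ hδ' hp) _)
  rw [← ENNReal.ofReal_mul hc]
  refine ENNReal.ofReal_le_ofReal ?_
  rw [mul_div_assoc']
  have := hψ p hp
  gcongr
  exact h p hp

/-- Conversion between the extended-valued fundamental function and real numbers. -/
theorem gFund_finite (hab : (a : EReal) < b) (hψ : ∀ p ∈ expInterval a b, 0 < ψ p)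
    {δ : ℝ} (hδ : 0 < δ) (hfin : gFund a b ψ δ ≠ ∞) :
    ∃ w : ℝ, 0 < w ∧ gFund a b ψ δ = ENNReal.ofReal w ∧
      ∀ p ∈ expInterval a b, δ ^ (1 / p) ≤ ψ p * w := by
  refine ⟨(gFund a b ψ δ).toReal, ENNReal.toReal_pos (gFund_pos hab hψ hδ).ne' hfin,
    (ENNReal.ofReal_toReal hfin).symm, fun p hp => ?_⟩
  have := (ENNReal.ofReal_le_iff_le_toReal hfin).1 (le_gFund hψ hδ hp)
  rwa [div_le_iff₀' (hψ p hp)] at this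

end Fundamental

/-! ### Indicators and rearrangements. -/

section Norms

variable {X : Type*} [MeasurableSpace X] {μ : Measure X}

theorem EquivSpaces.exists_pos {A B : (X → ℝ) → ℝ≥0∞} (h : EquivSpaces A B) :
    ∃ C : ℝ, 0 < C ∧ ∀ f : X → ℝ, Measurable f →
      A f ≤ ENNReal.ofReal C * B f ∧ B f ≤ ENNReal.ofReal C * A f := by
  obtain ⟨-, C, hC⟩ := h
  refine ⟨C + 1, by positivity, fun f hf => ?_⟩
  have : (C : ℝ≥0∞) ≤ ENNReal.ofReal (C + 1) := by
    rw [← ENNReal.ofReal_coe_nnreal]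
    exact ENNReal.ofReal_le_ofReal (by linarith)
  exact ⟨(hC f hf).1.trans (mul_le_mul_left this _), (hC f hf).2.trans (mul_le_mul_left this _)⟩

theorem lintegral_enorm_indicator_one_rpow {A : Set X} (hA : MeasurableSet A) {p : ℝ}
    (hp : 0 < p) : ∫⁻ x, ‖A.indicator (fun _ => (1 : ℝ)) x‖ₑ ^ p ∂μ = μ A := by
  rw [← lintegral_indicator_one hA]
  refine lintegral_congr fun x => ?_
  by_cases hx : x ∈ A <;> simp [hx, hp]

theorem gNorm_indicator {a : ℝ} {b : EReal} {ψ : ℝ → ℝ} (ha : 1 ≤ a) {A : Set X}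
    (hA : MeasurableSet A) {δ : ℝ} (hδ : μ A = ENNReal.ofReal δ) :
    gNorm μ a b ψ (A.indicator fun _ => (1 : ℝ)) = gFund a b ψ δ := by
  refine iSup_congr fun p => iSup_congr fun hp => ?_
  have : 0 < p := by linarith [hp.1]
  rw [eLpNorm', lintegral_enorm_indicator_one_rpow hA this, hδ]

theorem le_rearr_of_ae {f : X → ℝ} {t : ℝ} {c : ℝ≥0∞} {A : Set X}
    (hA : ENNReal.ofReal t < μ A) (h : ∀ᵐ x ∂μ, x ∈ A → c ≤ ‖f x‖ₑ) : c ≤ rearr μ f t :=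
  le_sInf fun s hs => by
    by_contra! hsc
    refine (hA.trans_le (measure_mono_ae ?_)).not_ge hs
    filter_upwards [h] with x hx hxA
    exact hsc.trans_le (hx hxA)

theorem rearr_le_of_forall_lt {f : X → ℝ} {t S : ℝ} (hS : 0 ≤ S)
    (h : ∀ s, S < s → μ {x | ENNReal.ofReal s < ‖f x‖ₑ} ≤ ENNReal.ofReal t) :
    rearr μ f t ≤ ENNReal.ofReal S := by
  refine ENNReal.le_of_forall_pos_le_add fun ε hε _ => ?_
  rw [← ENNReal.ofReal_coe_nnreal, ← ENNReal.ofReal_add hS (by positivity)]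
  exact sInf_le (h _ (by simpa using hε))

theorem rearr_indicator_of_lt {A : Set X} {δ t : ℝ} (hδ : μ A = ENNReal.ofReal δ) (ht : 0 ≤ t)
    (h : t < δ) : rearr μ (A.indicator fun _ => (1 : ℝ)) t = 1 := by
  refine le_antisymm (sInf_le ?_) (le_rearr_of_ae (A := A) ?_ (ae_of_all _ ?_))
  · have : {x | 1 < ‖A.indicator (fun _ => (1 : ℝ)) x‖ₑ} = ∅ := by
      refine eq_empty_of_forall_notMem fun x => ?_
      by_cases hx : x ∈ A <;> simp [hx]
    simp only [mem_ofPred_eq, this, measure_empty, zero_le]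
  · rw [hδ]; exact (ENNReal.ofReal_lt_ofReal_iff (ht.trans_lt h)).2 h
  · intro x hx; simp [hx]

theorem rearr_indicator_of_le {A : Set X} {δ t : ℝ} (hδ : μ A = ENNReal.ofReal δ)
    (h : δ ≤ t) : rearr μ (A.indicator fun _ => (1 : ℝ)) t = 0 := by
  refine le_antisymm (sInf_le ?_) zero_le
  refine (measure_mono (t := A) ?_).trans (hδ.trans_le (ENNReal.ofReal_le_ofReal h))
  intro x hx
  by_contra hxA
  simp [hxA] at hx

end Norms

/-! ### Orlicz spaces. -/

section Orlicz

variable {X : Type*} [MeasurableSpace X] {μ : Measure X}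

theorem IsOrliczFun.lintegral_indicator {Φ : ℝ≥0 → ℝ≥0∞} (hΦ : IsOrliczFun Φ) {A : Set X}
    (hA : MeasurableSet A) (k : ℝ≥0) :
    ∫⁻ x, Φ (‖A.indicator (fun _ => (1 : ℝ)) x‖₊ / k) ∂μ = Φ (1 / k) * μ A := by
  rw [← lintegral_indicator_const hA]
  refine lintegral_congr fun x => ?_
  by_cases hx : x ∈ A <;> simp [hx, hΦ.zero]

theorem orliczNorm_le {Φ : ℝ≥0 → ℝ≥0∞} {f : X → ℝ} {k : ℝ≥0} (hk : 0 < k)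
    (h : ∫⁻ x, Φ (‖f x‖₊ / k) ∂μ ≤ 1) : orliczNorm μ Φ f ≤ k :=
  iInf₂_le (f := fun (k : ℝ≥0) (_ : k ∈ {k : ℝ≥0 | 0 < k ∧ ∫⁻ x, Φ (‖f x‖₊ / k) ∂μ ≤ 1}) =>
    (k : ℝ≥0∞)) k ⟨hk, h⟩

/-- Convexity and `Φ(0) = 0` give `Φ(su) ≤ sΦ(u)` for `s ≤ 1`, which is small for small `s`. Hence
indicators of sets of finite measure have finite Luxemburg norm. -/
theorem IsOrliczFun.exists_mul_le_one {Φ : ℝ≥0 → ℝ≥0∞} (hΦ : IsOrliczFun Φ) {m : ℝ≥0∞}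
    (hm : m ≠ ∞) : ∃ v, 0 < v ∧ Φ v * m ≤ 1 := by
  obtain ⟨u, hu, hfin⟩ := hΦ.finite
  have hprod : Φ u * m ≠ ∞ := ENNReal.mul_ne_top hfin.ne hm
  set s : ℝ≥0 := ((Φ u * m).toNNReal + 1)⁻¹ with hs
  have hs0 : 0 < s := by positivity
  have hs1 : s ≤ 1 := inv_le_one_of_one_le₀ (by simp)
  refine ⟨s * u, mul_pos hs0 hu, ?_⟩
  have h := hΦ.convex u 0 s (1 - s) (add_tsub_cancel_of_le hs1)
  rw [hΦ.zero, mul_zero, mul_zero, add_zero, add_zero] at h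
  calc Φ (s * u) * m ≤ s * Φ u * m := mul_le_mul_left h _
    _ = ((s * (Φ u * m).toNNReal : ℝ≥0) : ℝ≥0∞) := by
        rw [ENNReal.coe_mul, ENNReal.coe_toNNReal hprod, mul_assoc]
    _ ≤ 1 := by
        rw [← ENNReal.coe_one, ENNReal.coe_le_coe, hs, inv_mul_le_one₀ (by positivity)]
        simp

theorem ComparableToMoments.gNorm_lt_top {a : ℝ} {b : EReal} {ψ : ℝ → ℝ} {g : X → ℝ}
    (h : ComparableToMoments μ a b ψ g) : gNorm μ a b ψ g < ∞ := by
  obtain ⟨c, C, hc, hC, hg⟩ := h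
  refine lt_of_le_of_lt (iSup₂_le fun p hp => ?_) (ENNReal.coe_lt_top (r := c⁻¹))
  refine ENNReal.div_le_of_le_mul ?_
  rw [ENNReal.coe_inv hc.ne', ← ENNReal.div_eq_inv_mul,
    ENNReal.le_div_iff_mul_le (Or.inl (by simpa using hc.ne')) (Or.inl (by simp)), mul_comm]
  exact (hg p hp).1

/-- If `Φ(2Cu) < 1/δ`, an indicator of measure `δ` has Luxemburg norm at most `1/(2Cu)`, hence `φ(δ)
≤ 1/(2u)`, while `1/φ(δ) ≤ u` says `φ(δ) ≥ 1/u`. No set has measure `δ > μ(X)`; such `δ` account for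
the term `1/μ(X)`, whose integral over `X` is at most `1`. -/
theorem gOrliczFun_le [SigmaFinite μ] (hd : IsDiffuse μ) {a : ℝ} {b : EReal} {ψ : ℝ → ℝ}
    (ha : 1 ≤ a) {Φ : ℝ≥0 → ℝ≥0∞} (hΦ : IsOrliczFun Φ) {C : ℝ≥0} (hC : 0 < C)
    (h : ∀ f : X → ℝ, Measurable f → gNorm μ a b ψ f ≤ C * orliczNorm μ Φ f) (u : ℝ≥0) :
    gOrliczFun a b ψ u ≤ Φ (2 * C * u) + (μ univ)⁻¹ := by
  refine iSup₂_le fun δ hδ => ?_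
  obtain ⟨hδ0, hδu⟩ := hδ
  rcases le_or_gt (ENNReal.ofReal δ) (μ univ) with hle | hgt
  · refine le_add_right ?_
    obtain ⟨A, -, hA, hAδ⟩ := hd.exists_subset MeasurableSet.univ hle
    have hφ := h _ ((measurable_const (a := (1 : ℝ))).indicator hA)
    rw [gNorm_indicator ha hA hAδ] at hφ
    have hδpos : ENNReal.ofReal δ ≠ 0 := by simpa using hδ0
    by_contra! hlt
    have hone : Φ (2 * C * u) * μ A ≤ 1 := by
      rw [hAδ]
      rw [one_div, ENNReal.ofReal_inv_of_pos hδ0] at hlt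
      calc Φ (2 * C * u) * ENNReal.ofReal δ ≤ (ENNReal.ofReal δ)⁻¹ * ENNReal.ofReal δ :=
            mul_le_mul_left hlt.le _
        _ ≤ 1 := ENNReal.inv_mul_le_one _
    -- At `u = 0` the condition on `δ` reads `φ(δ) = ∞`, impossible because the indicator has finite
    -- Luxemburg norm.
    rcases eq_or_ne u 0 with rfl | hu
    · obtain ⟨v, hv, hv1⟩ := hΦ.exists_mul_le_one (m := μ A) (by rw [hAδ]; simp)
      have hk : orliczNorm μ Φ (A.indicator fun _ => (1 : ℝ)) ≤ (v⁻¹ : ℝ≥0) :=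
        orliczNorm_le (by positivity) (by rw [hΦ.lintegral_indicator hA]; simpa using hv1)
      have htop : gFund a b ψ δ = ∞ := by simpa using hδu
      rw [htop, top_le_iff] at hφ
      exact (ENNReal.mul_lt_top ENNReal.coe_lt_top (hk.trans_lt ENNReal.coe_lt_top)).ne hφ
    · have hu0 : 0 < u := pos_iff_ne_zero.2 hu
      have hk : orliczNorm μ Φ (A.indicator fun _ => (1 : ℝ)) ≤ ((2 * C * u)⁻¹ : ℝ≥0) :=
        orliczNorm_le (by positivity) (by rw [hΦ.lintegral_indicator hA]; simpa using hone)
      have h1 : ((u⁻¹ : ℝ≥0) : ℝ≥0∞) ≤ gFund a b ψ δ := by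
        rw [ENNReal.coe_inv hu]
        exact ENNReal.inv_le_iff_inv_le.1 hδu
      have h2 := (h1.trans hφ).trans (mul_le_mul_right hk _)
      rw [← ENNReal.coe_mul, ENNReal.coe_le_coe] at h2
      have h3 : C * (2 * C * u)⁻¹ = u⁻¹ / 2 := by field_simp
      rw [h3] at h2
      exact (NNReal.half_lt_self (by positivity)).not_ge h2
  · refine le_add_left ?_
    rw [one_div, ENNReal.ofReal_inv_of_pos hδ0]
    exact ENNReal.inv_le_inv.2 hgt.le

theorem not_equivSpaces_orliczNorm [SigmaFinite μ] (hd : IsDiffuse μ) {a : ℝ} {b : EReal}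
    {ψ : ℝ → ℝ} (ha : 1 ≤ a) {g : X → ℝ} (hg : Measurable g) (hcomp : ComparableToMoments μ a b ψ g)
    (hdiv : ∀ ε : ℝ≥0, 0 < ε → ∫⁻ x, gOrliczFun a b ψ (ε * ‖g x‖₊) ∂μ = ∞)
    {Φ : ℝ≥0 → ℝ≥0∞} (hΦ : IsOrliczFun Φ) : ¬ EquivSpaces (gNorm μ a b ψ) (orliczNorm μ Φ) := by
  intro heq
  obtain ⟨C, hC, hCle⟩ := heq.exists_pos
  lift C to ℝ≥0 using hC.le
  simp only [ENNReal.ofReal_coe_nnreal] at hCle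
  have hC' : 0 < C := hC
  have hgO : orliczNorm μ Φ g < ∞ := (heq.1 g hg).1 hcomp.gNorm_lt_top
  obtain ⟨k, ⟨hk, hk1⟩, -⟩ := by simpa only [orliczNorm, iInf_lt_iff, exists_prop] using hgO
  -- This `ε` makes `2Cε|g| = |g|/k`, the argument at which `Φ` is known to be integrable.
  have hε : 0 < (2 * C * k)⁻¹ := by positivity
  refine (lt_of_le_of_lt ?_ (ENNReal.add_lt_top.2 ⟨hk1.trans_lt ENNReal.one_lt_top,
    ENNReal.one_lt_top⟩)).ne (hdiv _ hε)
  calc ∫⁻ x, gOrliczFun a b ψ ((2 * C * k)⁻¹ * ‖g x‖₊) ∂μ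
      ≤ ∫⁻ x, (Φ (‖g x‖₊ / k) + (μ univ)⁻¹) ∂μ := lintegral_mono fun x => by
        refine (gOrliczFun_le hd ha hΦ hC' (fun f hf => (hCle f hf).1) _).trans_eq ?_
        congr 2
        field_simp
    _ = ∫⁻ x, Φ (‖g x‖₊ / k) ∂μ + (μ univ)⁻¹ * μ univ := by
        rw [lintegral_add_right _ measurable_const, lintegral_const]
    _ ≤ _ := by gcongr; exact ENNReal.inv_mul_le_one _

end Orlicz

/-- The function inverse to `δ ↦ 1/φ(δ)`, where `φ` is the fundamental function of `G(ψ)` and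
`δ` is restricted to `0 < δ ≤ m`. -/
noncomputable def tailUpTo (m : ℝ≥0∞) (a : ℝ) (b : EReal) (ψ : ℝ → ℝ) (x : ℝ) : ℝ≥0∞ :=
  ⨆ δ ∈ {δ : ℝ | 0 < δ ∧ ENNReal.ofReal δ ≤ m ∧ ENNReal.ofReal x < (gFund a b ψ δ)⁻¹},
    ENNReal.ofReal δ

/-! ### The inverse function of `1/φ`. -/

section Tail

variable {m : ℝ≥0∞} {a : ℝ} {b : EReal} {ψ : ℝ → ℝ}

theorem tailUpTo_antitone : Antitone (tailUpTo m a b ψ) := fun _ _ h =>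
  iSup₂_le fun δ hδ =>
    le_iSup₂_of_le δ ⟨hδ.1, hδ.2.1, (ENNReal.ofReal_le_ofReal h).trans_lt hδ.2.2⟩ le_rfl

theorem tailUpTo_le (x : ℝ) : tailUpTo m a b ψ x ≤ m := iSup₂_le fun _ hδ => hδ.2.1

theorem ofReal_le_tailUpTo {δ x : ℝ} (hδ : 0 < δ) (hm : ENNReal.ofReal δ ≤ m)
    (hx : ENNReal.ofReal x < (gFund a b ψ δ)⁻¹) : ENNReal.ofReal δ ≤ tailUpTo m a b ψ x :=
  le_iSup₂_of_le (f := fun (δ : ℝ) (_ : δ ∈ {δ : ℝ | 0 < δ ∧ ENNReal.ofReal δ ≤ m ∧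
    ENNReal.ofReal x < (gFund a b ψ δ)⁻¹}) => ENNReal.ofReal δ) δ ⟨hδ, hm, hx⟩ le_rfl

theorem exists_of_lt_tailUpTo {t : ℝ≥0∞} {x : ℝ} (h : t < tailUpTo m a b ψ x) :
    ∃ δ : ℝ, 0 < δ ∧ ENNReal.ofReal δ ≤ m ∧ ENNReal.ofReal x < (gFund a b ψ δ)⁻¹ ∧
      t < ENNReal.ofReal δ := by
  simp only [tailUpTo, lt_iSup_iff] at h
  obtain ⟨δ, hδ, h⟩ := h
  exact ⟨δ, hδ.1, hδ.2.1, hδ.2.2, h⟩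

theorem tailUpTo_le_ofReal (ha : 1 ≤ a) {δ x : ℝ} (hx : (gFund a b ψ δ)⁻¹ ≤ ENNReal.ofReal x) :
    tailUpTo m a b ψ x ≤ ENNReal.ofReal δ := by
  by_contra! h
  obtain ⟨δ', -, -, hx', hlt⟩ := exists_of_lt_tailUpTo h
  have : δ ≤ δ' := (ENNReal.ofReal_lt_ofReal_iff'.1 hlt).1.le
  exact ((ENNReal.inv_le_inv.2 (gFund_mono ha this)).trans hx).not_gt hx'

/-- A Chebyshev-type bound: the single exponent `p` already gives `φ(δ) ≥ δ^(1/p)/ψ(p)`. It makes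
the tail finite and forces it to vanish at infinity. -/
theorem tailUpTo_le_rpow (ha : 1 ≤ a) (hψ : ∀ p ∈ expInterval a b, 0 < ψ p) {p x : ℝ}
    (hp : p ∈ expInterval a b) (hx : 0 < x) :
    tailUpTo m a b ψ x ≤ ENNReal.ofReal ((ψ p / x) ^ p) := by
  refine iSup₂_le fun δ ⟨hδ, _, hlt⟩ => ENNReal.ofReal_le_ofReal ?_
  have hp0 : 0 < p := by linarith [hp.1]
  have hψp := hψ p hp
  have hpos : 0 < δ ^ (1 / p) := by positivity
  have h := hlt.trans_le (ENNReal.inv_le_inv.2 (le_gFund hψ hδ hp))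
  rw [← ENNReal.ofReal_inv_of_pos (by positivity), inv_div] at h
  have h1 : x < ψ p / δ ^ (1 / p) := (ENNReal.ofReal_lt_ofReal_iff'.1 h).1
  have h2 : δ ^ (1 / p) ≤ ψ p / x := by
    rw [lt_div_iff₀ hpos] at h1
    rw [le_div_iff₀ hx, mul_comm]
    exact h1.le
  calc δ = (δ ^ (1 / p)) ^ p := by
        rw [← Real.rpow_mul hδ.le, one_div_mul_cancel hp0.ne', Real.rpow_one]
    _ ≤ _ := Real.rpow_le_rpow hpos.le h2 hp0.le

theorem exists_tailUpTo_le (ha : 1 ≤ a) (hab : (a : EReal) < b)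
    (hψ : ∀ p ∈ expInterval a b, 0 < ψ p) {ε : ℝ≥0} (hε : 0 < ε) :
    ∃ x, tailUpTo m a b ψ x ≤ ε := by
  obtain ⟨p, hp⟩ := exists_mem_expInterval hab
  have hp0 : 0 < p := by linarith [hp.1]
  have hψp := hψ p hp
  have hε' : (0 : ℝ) < ε := hε
  refine ⟨ψ p / ε ^ (1 / p), (tailUpTo_le_rpow ha hψ hp (by positivity)).trans_eq ?_⟩
  rw [div_div_cancel₀ hψp.ne', ← Real.rpow_mul hε'.le, one_div_mul_cancel hp0.ne', Real.rpow_one,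
    ENNReal.ofReal_coe_nnreal]

end Tail

/-! ### Marcinkiewicz spaces with the functional `sup θ f^*`. -/

section

variable {X : Type*} [MeasurableSpace X] {μ : Measure X}
variable {m : ℝ≥0∞} {a : ℝ} {b : EReal} {ψ : ℝ → ℝ}

theorem IsDiffuse.exists_tailUpTo [SigmaFinite μ] (hd : IsDiffuse μ) (hm : m ≤ μ univ)
    (ha : 1 ≤ a) (hab : (a : EReal) < b) (hψ : ∀ p ∈ expInterval a b, 0 < ψ p) :
    ∃ f : X → ℝ, Measurable f ∧ ∀ x, 0 < x →
      tailUpTo m a b ψ x ≤ μ {y | ENNReal.ofReal x < ‖f y‖ₑ} ∧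
        μ {y | ENNReal.ofReal x < ‖f y‖ₑ} ≤ tailUpTo m a b ψ (x / 2) := by
  refine hd.exists_tail tailUpTo_antitone (fun x hx => ?_) (fun x => (tailUpTo_le x).trans hm)
    fun ε hε => ?_
  · obtain ⟨p, hp⟩ := exists_mem_expInterval hab
    exact ((tailUpTo_le_rpow ha hψ hp hx).trans_lt ENNReal.ofReal_lt_top).ne
  · induction ε using ENNReal.recTopCoe with
    | top => exact ⟨0, le_top⟩
    | coe ε => exact exists_tailUpTo_le ha hab hψ (by simpa using hε)

/-- The layer-cake formula, with its factor `p ≥ 1` dropped. -/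
theorem lintegral_rpow_mul_tail_le {f : X → ℝ} (hf : Measurable f) {T : ℝ → ℝ≥0∞}
    (hT : ∀ x, 0 < x → T x ≤ μ {y | ENNReal.ofReal x < ‖f y‖ₑ}) {p : ℝ} (hp : 1 ≤ p) :
    ∫⁻ x in Ioi (0 : ℝ), ENNReal.ofReal x ^ (p - 1) * T x ≤ ∫⁻ y, ‖f y‖ₑ ^ p ∂μ := by
  have hp0 : 0 < p := by linarith
  have h := lintegral_rpow_eq_lintegral_meas_lt_mul μ (f := fun y => |f y|)
    (ae_of_all _ fun y => abs_nonneg _) (measurable_abs.comp hf).aemeasurable hp0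
  have h1 : ∫⁻ y, ‖f y‖ₑ ^ p ∂μ = ∫⁻ y, ENNReal.ofReal (|f y| ^ p) ∂μ :=
    lintegral_congr fun y => by
      rw [← ENNReal.ofReal_rpow_of_nonneg (abs_nonneg _) hp0.le, Real.enorm_eq_ofReal_abs]
  rw [h1, h]
  refine le_trans (setLIntegral_mono' measurableSet_Ioi fun x hx => ?_)
    (le_mul_of_one_le_left zero_le (by simpa using hp))
  have hx' : 0 < x := hx
  rw [mul_comm, ENNReal.ofReal_rpow_of_pos hx']
  refine mul_le_mul_left ((hT x hx').trans_eq ?_) _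
  congr 1
  ext y
  simp only [mem_ofPred_eq]
  rw [Real.enorm_eq_ofReal_abs, ENNReal.ofReal_lt_ofReal_iff_of_nonneg hx'.le]

theorem rpow_lintegral_tail_div_le_gNorm {f : X → ℝ} (hf : Measurable f) {T : ℝ → ℝ≥0∞}
    (hT : ∀ x, 0 < x → T x ≤ μ {y | ENNReal.ofReal x < ‖f y‖ₑ}) (ha : 1 ≤ a) :
    (⨆ p ∈ expInterval a b, (∫⁻ x in Ioi (0 : ℝ), ENNReal.ofReal x ^ (p - 1) * T x) ^ (1 / p) /
      ENNReal.ofReal (ψ p)) ≤ gNorm μ a b ψ f := by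
  refine iSup₂_mono fun p hp => ENNReal.div_le_div_right ?_ _
  have : 1 ≤ p := ha.trans hp.1.le
  exact ENNReal.rpow_le_rpow (lintegral_rpow_mul_tail_le hf hT this)
    (one_div_nonneg.2 (by linarith))

theorem not_equivSpaces_marcNorm [SigmaFinite μ] (hd : IsDiffuse μ) (ha : 1 ≤ a)
    (hab : (a : EReal) < b) (hψ : ∀ p ∈ expInterval a b, 0 < ψ p)
    (hdiv : (⨆ p ∈ expInterval a b,
        (∫⁻ x in Ioi (0 : ℝ), ENNReal.ofReal x ^ (p - 1) * gTail μ a b ψ x) ^ (1 / p) /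
          ENNReal.ofReal (ψ p)) = ∞)
    {θ : ℝ → ℝ} (hθ : ∀ δ, 0 < δ → 0 < θ δ) : ¬ EquivSpaces (gNorm μ a b ψ) (marcNorm μ θ) := by
  intro heq
  obtain ⟨C, hC, hCle⟩ := heq.exists_pos
  obtain ⟨f, hf, hfT⟩ := hd.exists_tailUpTo le_rfl ha hab hψ
  -- Here `gTail μ` unfolds to `tailUpTo (μ univ)`.
  have hG : gNorm μ a b ψ f = ∞ :=
    top_le_iff.1 (hdiv.symm.le.trans
      (rpow_lintegral_tail_div_le_gNorm hf (fun x hx => (hfT x hx).1) ha))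
  refine ((heq.1 f hf).2 (lt_of_le_of_lt (iSup₂_le fun δ hδ => ?_)
    (ENNReal.ofReal_lt_top (r := 2 * C)))).ne hG
  have hδ' : 0 < δ := hδ
  have hθδ := hθ δ hδ
  -- Otherwise some `δ' > δ` has `φ(δ') < 2/s` with `s > 2C/θ(δ)`; an indicator of measure `δ'`
  -- gives `θ(δ) ≤ Cφ(δ')`, a contradiction. The factor `2` comes from the dilation in the tail of
  -- `f`.
  have key : rearr μ f δ ≤ ENNReal.ofReal (2 * C / θ δ) := by
    refine rearr_le_of_forall_lt (by positivity) fun s hs => ?_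
    have hs0 : 0 < s := lt_trans (by positivity) hs
    refine (hfT s hs0).2.trans ?_
    by_contra! hlt
    obtain ⟨δ', hδ'0, hm, hlt', hδδ'⟩ := exists_of_lt_tailUpTo hlt
    obtain ⟨A, -, hA, hAδ⟩ := hd.exists_subset MeasurableSet.univ hm
    have h1 := (hCle _ ((measurable_const (a := (1 : ℝ))).indicator hA)).2
    rw [gNorm_indicator ha hA hAδ] at h1
    have h2 : ENNReal.ofReal (θ δ) ≤ marcNorm μ θ (A.indicator fun _ => (1 : ℝ)) := by
      refine le_trans ?_ (le_iSup₂ (f := fun (δ : ℝ) (_ : δ ∈ Ioi (0 : ℝ)) =>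
        ENNReal.ofReal (θ δ) * rearr μ (A.indicator fun _ => (1 : ℝ)) δ) δ hδ)
      rw [rearr_indicator_of_lt hAδ hδ'.le ((ENNReal.ofReal_lt_ofReal_iff'.1 hδδ').1), mul_one]
    have h3 : ENNReal.ofReal (θ δ * (s / 2)) ≤ ENNReal.ofReal C := by
      rw [ENNReal.ofReal_mul hθδ.le]
      calc _ ≤ ENNReal.ofReal C * gFund a b ψ δ' * (gFund a b ψ δ')⁻¹ :=
            mul_le_mul' (h2.trans h1) hlt'.le
        _ ≤ ENNReal.ofReal C * 1 := by
            rw [mul_assoc]; exact mul_le_mul_right (ENNReal.mul_inv_le_one _) _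
        _ = _ := mul_one _
    rw [ENNReal.ofReal_le_ofReal_iff hC.le] at h3
    rw [div_lt_iff₀ hθδ] at hs
    linarith
  calc _ ≤ ENNReal.ofReal (θ δ) * ENNReal.ofReal (2 * C / θ δ) := mul_le_mul_right key _
    _ = ENNReal.ofReal (2 * C) := by
      rw [← ENNReal.ofReal_mul hθδ.le, mul_div_cancel₀ _ hθδ.ne']

end

theorem tendsto_const_mul_rpow_nhdsGT_zero (c : ℝ) {r : ℝ} (hr : 0 < r) :
    Tendsto (fun x : ℝ => c * x ^ r) (𝓝[>] 0) (𝓝 0) := by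
  have : ContinuousAt (fun x : ℝ => c * x ^ r) 0 :=
    continuousAt_const.mul (Real.continuousAt_rpow_const _ _ (Or.inr hr.le))
  have h := this.tendsto
  simp only [Real.zero_rpow hr.ne', mul_zero] at h
  exact h.mono_left nhdsWithin_le_nhds

/-! ### Power growth of the fundamental function. -/

section Fundamental

variable {a : ℝ} {b : EReal} {ψ : ℝ → ℝ}

theorem rpow_one_div_le_mul {s h p q : ℝ} (hq : 0 < q) (hqp : q ≤ p) (hs : 0 < s) (hsh : s ≤ h) :
    h ^ (1 / p) ≤ (h / s) ^ (1 / q) * s ^ (1 / p) := by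
  have h1 : 1 ≤ h / s := (one_le_div hs).2 hsh
  calc h ^ (1 / p) = (h / s) ^ (1 / p) * s ^ (1 / p) := by
        rw [← Real.mul_rpow (by positivity) hs.le, div_mul_cancel₀ _ hs.ne']
    _ ≤ _ := by
        refine mul_le_mul_of_nonneg_right (Real.rpow_le_rpow_of_exponent_le h1 ?_) (by positivity)
        exact one_div_le_one_div_of_le hq hqp

theorem gFund_growth (ha : 1 ≤ a) (hψ : ∀ p ∈ expInterval a b, 0 < ψ p) {s h : ℝ} (hs : 0 < s)
    (hsh : s ≤ h) :
    gFund a b ψ h ≤ ENNReal.ofReal ((h / s) ^ (1 / a)) * gFund a b ψ s := by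
  have hh := hs.trans_le hsh
  exact gFund_le_mul hψ hh hs (by positivity)
    fun p hp => rpow_one_div_le_mul (by linarith) hp.1.le hs hsh

/-- For a fixed `q` in `(a,b)`, exponents `p ≥ q` grow at most like `(h/s)^(1/q)`. For `p < q` and
`h ≤ 1` one has `h^(1/p) ≤ h^(1/q)`, and finiteness of `φ(1)` bounds `ψ` below, so these terms are
controlled by the one at `q`. -/
theorem exists_gFund_growth_of_le_one (ha : 1 ≤ a) (hab : (a : EReal) < b)
    (hψ : ∀ p ∈ expInterval a b, 0 < ψ p) (hfin : gFund a b ψ 1 ≠ ∞) :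
    ∃ q A : ℝ, 1 < q ∧ 0 < A ∧ ∀ s h : ℝ, 0 < s → s ≤ h → h ≤ 1 →
      gFund a b ψ h ≤ ENNReal.ofReal (A * (h / s) ^ (1 / q)) * gFund a b ψ s := by
  obtain ⟨q, hq⟩ := exists_mem_expInterval hab
  have hq1 : 1 < q := ha.trans_lt hq.1
  obtain ⟨K, hK, -, hKψ⟩ := gFund_finite hab hψ one_pos hfin
  have hψq := hψ q hq
  refine ⟨q, max 1 (K * ψ q), hq1, by positivity, fun s h hs hsh h1 => ?_⟩
  have hh := hs.trans_le hsh
  refine gFund_le hψ hh fun p hp => ?_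
  have hψp := hψ p hp
  have hp0 : 0 < p := by linarith [hp.1]
  rcases le_or_gt q p with hqp | hpq
  · refine le_trans ?_ (mul_le_mul_right (le_gFund hψ hs hp) _)
    rw [← ENNReal.ofReal_mul (by positivity)]
    refine ENNReal.ofReal_le_ofReal ?_
    rw [mul_div_assoc']
    gcongr
    refine (rpow_one_div_le_mul (by linarith) hqp hs hsh).trans ?_
    gcongr
    exact le_mul_of_one_le_left (by positivity) (le_max_left _ _)
  · refine le_trans ?_ (mul_le_mul_right (le_gFund hψ hs hq) _)
    rw [← ENNReal.ofReal_mul (by positivity)]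
    refine ENNReal.ofReal_le_ofReal ?_
    have h2 : 1 ≤ ψ p * K := by simpa using hKψ p hp
    calc h ^ (1 / p) / ψ p ≤ K * h ^ (1 / q) := by
          rw [div_le_iff₀ hψp]
          have h3 : h ^ (1 / p) ≤ h ^ (1 / q) :=
            Real.rpow_le_rpow_of_exponent_ge hh h1 (one_div_le_one_div_of_le hp0 hpq.le)
          have h4 : 0 < h ^ (1 / q) := by positivity
          nlinarith
      _ = K * ψ q * (h / s) ^ (1 / q) * (s ^ (1 / q) / ψ q) := by
          have h5 : h ^ (1 / q) = (h / s) ^ (1 / q) * s ^ (1 / q) := by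
            rw [← Real.mul_rpow (by positivity) hs.le, div_mul_cancel₀ _ hs.ne']
          rw [h5]
          field_simp
      _ ≤ _ := by
          gcongr
          exact le_max_right _ _

end Fundamental

/-! ### Marcinkiewicz spaces in integral form: sufficiency of power growth. -/

section

variable {X : Type*} [MeasurableSpace X] {μ : Measure X}

theorem IsQuasiConcave.min_div_le {θ : ℝ → ℝ} (hθ : IsQuasiConcave θ) {δ h : ℝ} (hδ : 0 < δ)
    (hh : 0 < h) : min δ h / θ h ≤ δ / θ δ := by
  have h1 := hθ.pos δ hδ
  have h2 := hθ.pos h hh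
  rcases le_total δ h with hle | hle
  · rw [min_eq_left hle]
    gcongr
    exact hθ.mono hle
  · rw [min_eq_right hle]
    have := hθ.anti (mem_Ioi.2 hh) (mem_Ioi.2 hδ) hle
    simp only at this
    rw [div_le_div_iff₀ hδ hh] at this
    rw [div_le_div_iff₀ h2 h1]
    linarith

theorem marcIntNorm_indicator_lt_top {θ : ℝ → ℝ} (hθ : IsQuasiConcave θ) {A : Set X} {δ : ℝ}
    (hδ : 0 < δ) (hA : μ A = ENNReal.ofReal δ) :
    marcIntNorm μ θ (A.indicator fun _ => (1 : ℝ)) < ∞ := by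
  refine lt_of_le_of_lt (iSup₂_le fun h hh => ?_) (ENNReal.ofReal_lt_top (r := δ / θ δ))
  have hh0 : 0 < h := hh
  have hint : ∫⁻ s in Ioo 0 h, rearr μ (A.indicator fun _ => (1 : ℝ)) s ≤
      ENNReal.ofReal (min δ h) := by
    calc _ ≤ ∫⁻ s in Ioo 0 h, (Iio δ).indicator 1 s :=
          setLIntegral_mono' measurableSet_Ioo fun s hs => by
            rcases lt_or_ge s δ with hlt | hge
            · rw [rearr_indicator_of_lt hA hs.1.le hlt]; simp [hlt]
            · rw [rearr_indicator_of_le hA hge]; simp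
      _ = volume (Iio δ ∩ Ioo 0 h) := by
          rw [lintegral_indicator_one measurableSet_Iio, Measure.restrict_apply measurableSet_Iio]
      _ ≤ volume (Ioo 0 (min δ h)) := measure_mono fun s hs => ⟨hs.2.1, lt_min hs.1 hs.2.2⟩
      _ = _ := by simp
  refine (ENNReal.div_le_div_right hint _).trans ?_
  rw [← ENNReal.ofReal_div_of_pos (hθ.pos h hh0)]
  exact ENNReal.ofReal_le_ofReal (hθ.min_div_le hδ hh0)

theorem le_marcIntNorm_indicator {θ : ℝ → ℝ} (hθ : IsQuasiConcave θ) {A : Set X} {δ : ℝ}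
    (hδ : 0 < δ) (hA : μ A = ENNReal.ofReal δ) :
    ENNReal.ofReal (δ / θ δ) ≤ marcIntNorm μ θ (A.indicator fun _ => (1 : ℝ)) := by
  refine le_trans (le_of_eq ?_) (le_iSup₂ (f := fun (h : ℝ) (_ : h ∈ Ioi (0 : ℝ)) =>
    (∫⁻ s in Ioo 0 h, rearr μ (A.indicator fun _ => (1 : ℝ)) s) / ENNReal.ofReal (θ h)) δ hδ)
  rw [ENNReal.ofReal_div_of_pos (hθ.pos δ hδ)]
  congr 1
  rw [setLIntegral_congr_fun (g := fun _ => 1) measurableSet_Ioo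
    fun s hs => rearr_indicator_of_lt hA hs.1.le hs.2]
  simp

theorem lintegral_Ioo_rpow_neg {r h : ℝ} (hr : r < 1) (hh : 0 < h) :
    ∫⁻ s in Ioo 0 h, ENNReal.ofReal (s ^ (-r)) = ENNReal.ofReal (h ^ (1 - r) / (1 - r)) := by
  have hi : IntegrableOn (fun s : ℝ => s ^ (-r)) (Ioo 0 h) :=
    ((intervalIntegrable_iff_integrableOn_Ioo_of_le hh.le).1
      (intervalIntegral.intervalIntegrable_rpow' (by linarith)))
  rw [← ofReal_integral_eq_lintegral_ofReal hi]
  · congr 1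
    rw [← integral_Ioc_eq_integral_Ioo, ← intervalIntegral.integral_of_le hh.le,
      integral_rpow (Or.inl (by linarith)), Real.zero_rpow (by linarith)]
    rw [sub_zero, neg_add_eq_sub]
  · filter_upwards [ae_restrict_mem measurableSet_Ioo] with s hs
    have := hs.1
    positivity

/-- The tail bound gives `f^* ≤ 2/φ`, and growth gives `1/φ(s) ≤ A(h/s)^(1/q)/φ(h)`. Since `q > 1`
this is integrable at zero, and the integral over `(0,h)` is a multiple of `h/φ(h) ≤ Cθ(h)`. -/
theorem marcIntNorm_lt_top_of_growth {m : ℝ≥0∞} {a : ℝ} {b : EReal} {ψ : ℝ → ℝ} (hm : 0 < m)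
    (ha : 1 ≤ a) (hab : (a : EReal) < b) (hψ : ∀ p ∈ expInterval a b, 0 < ψ p)
    {q A C : ℝ} (hq : 1 < q) (hA : 0 < A) (hC : 0 < C)
    (hfin : ∀ h : ℝ, 0 < h → ENNReal.ofReal h ≤ m → gFund a b ψ h ≠ ∞)
    (hgrow : ∀ s h : ℝ, 0 < s → s ≤ h → ENNReal.ofReal h ≤ m →
      gFund a b ψ h ≤ ENNReal.ofReal (A * (h / s) ^ (1 / q)) * gFund a b ψ s)
    {θ : ℝ → ℝ} (hθ : IsQuasiConcave θ)
    (hθφ : ∀ h : ℝ, 0 < h → ENNReal.ofReal h ≤ m →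
      ENNReal.ofReal (h / θ h) ≤ ENNReal.ofReal C * gFund a b ψ h)
    {f : X → ℝ} (hf : ∀ x, 0 < x →
      μ {y | ENNReal.ofReal x < ‖f y‖ₑ} ≤ tailUpTo m a b ψ (x / 2)) :
    marcIntNorm μ θ f < ∞ := by
  have hq' : 0 < 1 - 1 / q := by
    rw [sub_pos, div_lt_one (by linarith)]; exact hq
  set D : ℝ := 2 * A * C / (1 - 1 / q) with hD
  have hDpos : 0 < D := by positivity
  have hsmall : ∀ h : ℝ, 0 < h → ENNReal.ofReal h ≤ m →
      ∫⁻ s in Ioo 0 h, rearr μ f s ≤ ENNReal.ofReal (D * θ h) := by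
    intro h hh hhm
    have hθh := hθ.pos h hh
    obtain ⟨w, hw, hφw, -⟩ := gFund_finite hab hψ hh (hfin h hh hhm)
    have hwθ : h ≤ C * w * θ h := by
      have := hθφ h hh hhm
      rw [hφw, ← ENNReal.ofReal_mul hC.le, ENNReal.ofReal_le_ofReal_iff (by positivity),
        div_le_iff₀ hθh] at this
      exact this
    calc ∫⁻ s in Ioo 0 h, rearr μ f s
        ≤ ∫⁻ s in Ioo 0 h, ENNReal.ofReal (2 * A * C * θ h * h ^ (1 / q - 1)) *
            ENNReal.ofReal (s ^ (-(1 / q))) := by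
          refine setLIntegral_mono' measurableSet_Ioo fun s hs => ?_
          obtain ⟨hs0, hsh⟩ := hs
          have hsm : ENNReal.ofReal s ≤ m := (ENNReal.ofReal_le_ofReal hsh.le).trans hhm
          obtain ⟨v, hv, hφv, -⟩ := gFund_finite hab hψ hs0 (hfin s hs0 hsm)
          have hr : rearr μ f s ≤ ENNReal.ofReal (2 / v) := by
            refine rearr_le_of_forall_lt (by positivity) fun x hx => ?_
            have hx0 : 0 < x := lt_trans (by positivity) hx
            refine (hf x hx0).trans (tailUpTo_le_ofReal ha ?_)
            rw [hφv, ← ENNReal.ofReal_inv_of_pos hv]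
            refine ENNReal.ofReal_le_ofReal ?_
            rw [inv_eq_one_div, div_le_iff₀ hv]
            rw [div_lt_iff₀ hv] at hx
            linarith
          refine hr.trans ?_
          rw [← ENNReal.ofReal_mul (by positivity)]
          refine ENNReal.ofReal_le_ofReal ?_
          have hg := hgrow s h hs0 hsh.le hhm
          rw [hφw, hφv, ← ENNReal.ofReal_mul (by positivity),
            ENNReal.ofReal_le_ofReal_iff (by positivity)] at hg
          have hid : h * (h ^ (1 / q - 1) * s ^ (-(1 / q))) = (h / s) ^ (1 / q) := by
            rw [Real.rpow_sub_one hh.ne', Real.rpow_neg hs0.le, Real.div_rpow hh.le hs0.le]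
            field_simp
          set z := h ^ (1 / q - 1) * s ^ (-(1 / q)) with hz
          have hz0 : 0 < z := by positivity
          rw [← hid] at hg
          rw [mul_assoc, ← hz, div_le_iff₀ hv]
          have h1 : h * w ≤ C * w * θ h * (A * (h * z) * v) :=
            mul_le_mul hwθ hg hw.le (by positivity)
          have h2 : (h * w) * 2 ≤ (h * w) * (2 * A * C * θ h * z * v) := by nlinarith
          exact le_of_mul_le_mul_left h2 (by positivity)
      _ = ENNReal.ofReal (D * θ h) := by
          rw [lintegral_const_mul' _ _ ENNReal.ofReal_ne_top,
            lintegral_Ioo_rpow_neg (by linarith) hh, ← ENNReal.ofReal_mul (by positivity)]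
          congr 1
          have : h ^ (1 / q - 1) * h ^ (1 - 1 / q) = 1 := by
            rw [← Real.rpow_add hh]; simp
          rw [hD]
          calc _ = 2 * A * C * θ h * (h ^ (1 / q - 1) * h ^ (1 - 1 / q)) / (1 - 1 / q) := by ring
            _ = _ := by rw [this]; ring
  refine lt_of_le_of_lt (iSup₂_le fun h hh => ?_) (ENNReal.ofReal_lt_top (r := D))
  have hh0 : 0 < h := hh
  have hθh := hθ.pos h hh0
  refine ENNReal.div_le_of_le_mul ?_
  rw [← ENNReal.ofReal_mul hDpos.le]
  rcases le_or_gt (ENNReal.ofReal h) m with hle | hgt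
  · exact hsmall h hh0 hle
  -- Beyond `m` the rearrangement vanishes and `θ` only increases, so the bound at `m` is enough.
  · have hmtop : m ≠ ∞ := (hgt.trans ENNReal.ofReal_lt_top).ne
    set m' := m.toReal with hm'
    have hmm : ENNReal.ofReal m' = m := ENNReal.ofReal_toReal hmtop
    have hm'0 : 0 < m' := ENNReal.toReal_pos hm.ne' hmtop
    have hm'h : m' ≤ h := by
      rw [← hmm] at hgt
      exact (ENNReal.ofReal_lt_ofReal_iff'.1 hgt).1.le
    calc ∫⁻ s in Ioo 0 h, rearr μ f s
        ≤ ∫⁻ s in Ioo 0 h, (Ioo 0 m').indicator (rearr μ f) s := by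
          refine setLIntegral_mono' measurableSet_Ioo fun s hs => ?_
          rcases lt_or_ge s m' with hlt | hge
          · have hmem : s ∈ Ioo 0 m' := ⟨hs.1, hlt⟩
            rw [indicator_of_mem hmem]
          · have : rearr μ f s ≤ ENNReal.ofReal 0 :=
              rearr_le_of_forall_lt le_rfl fun x hx => ((hf x hx).trans (tailUpTo_le _)).trans
                (hmm.symm.le.trans (ENNReal.ofReal_le_ofReal hge))
            exact this.trans (by simp)
      _ ≤ ∫⁻ s, (Ioo 0 m').indicator (rearr μ f) s := setLIntegral_le_lintegral _ _
      _ = ∫⁻ s in Ioo 0 m', rearr μ f s := lintegral_indicator measurableSet_Ioo _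
      _ ≤ ENNReal.ofReal (D * θ m') := hsmall m' hm'0 hmm.le
      _ ≤ _ := ENNReal.ofReal_le_ofReal (mul_le_mul_of_nonneg_left (hθ.mono hm'h) hDpos.le)

end

/-! ### The case of finite `b`, and the integral Marcinkiewicz theorem. -/

section

variable {X : Type*} [MeasurableSpace X] {μ : Measure X}

/-- For `y ≤ 1` and `p < b` one has `y^(b/p) ≤ y`, so shrinking the measure by `y^b` lowers `φ` at
least by the factor `y`. With `y = 1/(2wx)` this gives `φ ≤ 1/(2x)`: the tail decays no faster than
`x^(-b)`. -/
theorem le_tailUpTo_one {a b : ℝ} {ψ : ℝ → ℝ} (ha : 1 ≤ a)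
    (hψ : ∀ p ∈ expInterval a b, 0 < ψ p) {h w x : ℝ} (hh : 0 < h) (h1 : h ≤ 1) (hb : 0 < b)
    (hw : 0 < w) (hφ : gFund a b ψ h = ENNReal.ofReal w) (hx : w⁻¹ < x) :
    ENNReal.ofReal (h * ((2 * w)⁻¹ / x) ^ b) ≤ tailUpTo 1 a b ψ x := by
  have hx0 : 0 < x := lt_trans (by positivity) hx
  set y : ℝ := (2 * w)⁻¹ / x with hy
  have hy0 : 0 < y := by positivity
  have hwx : 1 < x * w := by rwa [inv_lt_iff_one_lt_mul₀ hw] at hx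
  have hyw : y * w = (2 * x)⁻¹ := by rw [hy]; field_simp
  have hy1 : y ≤ 1 := by
    rw [hy, div_le_one hx0]
    refine le_trans ?_ hx.le
    exact inv_anti₀ hw (by linarith)
  have hl1 : y ^ b ≤ 1 := Real.rpow_le_one hy0.le hy1 hb.le
  have hl0 : 0 < y ^ b := by positivity
  refine ofReal_le_tailUpTo (by positivity) ?_ ?_
  · rw [← ENNReal.ofReal_one]
    exact ENNReal.ofReal_le_ofReal (mul_le_one₀ h1 hl0.le hl1)
  · have hle : gFund a b ψ (h * y ^ b) ≤ ENNReal.ofReal y * gFund a b ψ h := by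
      refine gFund_le_mul hψ (by positivity) hh hy0.le fun p hp => ?_
      have hp0 : 0 < p := by linarith [hp.1]
      have hpb : p < b := EReal.coe_lt_coe_iff.1 hp.2
      rw [Real.mul_rpow hh.le hl0.le, mul_comm, ← Real.rpow_mul hy0.le]
      refine mul_le_mul_of_nonneg_right ?_ (by positivity)
      calc y ^ (b * (1 / p)) ≤ y ^ (1 : ℝ) := by
            refine Real.rpow_le_rpow_of_exponent_ge hy0 hy1 ?_
            rw [mul_one_div, one_le_div hp0]
            exact hpb.le
        _ = y := Real.rpow_one y
    rw [hφ, ← ENNReal.ofReal_mul hy0.le, hyw] at hle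
    refine lt_of_lt_of_le ?_ (ENNReal.inv_le_inv.2 hle)
    rw [← ENNReal.ofReal_inv_of_pos (by positivity), inv_inv]
    exact (ENNReal.ofReal_lt_ofReal_iff (by positivity)).2 (by linarith)

/-- Integration of the lower bound `x^(-b)` against `x^(p-1)` produces the factor `1/(b-p)`, which
blows up at the right endpoint. -/
theorem le_lintegral_rpow_mul_tailUpTo_one {a b : ℝ} {ψ : ℝ → ℝ} (ha : 1 ≤ a)
    (hψ : ∀ p ∈ expInterval a b, 0 < ψ p) {h w p : ℝ} (hh : 0 < h) (h1 : h ≤ 1)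
    (hp : p ∈ expInterval a b)
    (hw : 0 < w) (hφ : gFund a b ψ h = ENNReal.ofReal w) :
    ENNReal.ofReal (h * (2⁻¹ ^ b * w⁻¹ ^ p / (b - p))) ≤
      ∫⁻ x in Ioi (0 : ℝ), ENNReal.ofReal x ^ (p - 1) * tailUpTo 1 a b ψ x := by
  have hpb : p < b := EReal.coe_lt_coe_iff.1 hp.2
  have hp1 : 1 < p := ha.trans_lt hp.1
  have hw' : 0 < w⁻¹ := by positivity
  have hint := integrableOn_Ioi_rpow_of_lt (show p - 1 - b < -1 by linarith) hw'
  calc ENNReal.ofReal (h * (2⁻¹ ^ b * w⁻¹ ^ p / (b - p)))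
      = ∫⁻ x in Ioi w⁻¹, ENNReal.ofReal (h * (2 * w)⁻¹ ^ b * x ^ (p - 1 - b)) := by
        rw [← ofReal_integral_eq_lintegral_ofReal (hint.const_mul _)]
        · congr 1
          rw [integral_const_mul, integral_Ioi_rpow_of_lt (by linarith) hw',
            mul_inv, Real.mul_rpow (by positivity) hw'.le]
          have e1 : p - 1 - b + 1 = p - b := by ring
          have e2 : w⁻¹ ^ (p - b) = w⁻¹ ^ p / w⁻¹ ^ b := Real.rpow_sub hw' _ _
          have e3 : b - p ≠ 0 := by linarith
          have e4 : p - b ≠ 0 := by linarith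
          have e5 : 0 < w⁻¹ ^ b := by positivity
          have e6 : p - b = -(b - p) := by ring
          rw [e1, e2, e6]
          field_simp
        · filter_upwards [ae_restrict_mem measurableSet_Ioi] with x hx
          have : 0 < x := hw'.trans hx
          positivity
    _ ≤ ∫⁻ x in Ioi w⁻¹, ENNReal.ofReal x ^ (p - 1) * tailUpTo 1 a b ψ x := by
        refine setLIntegral_mono' measurableSet_Ioi fun x hx => ?_
        have hx0 : 0 < x := hw'.trans hx
        refine le_trans (le_of_eq ?_)
          (mul_le_mul_right (le_tailUpTo_one ha hψ hh h1 (by linarith) hw hφ hx) _)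
        rw [ENNReal.ofReal_rpow_of_pos hx0, ← ENNReal.ofReal_mul (by positivity)]
        congr 1
        rw [Real.rpow_sub hx0, Real.div_rpow (by positivity) hx0.le]
        ring
    _ ≤ _ := lintegral_mono_set (Ioi_subset_Ioi hw'.le)

theorem lintegral_rpow_le_of_eLpNorm'_le {f : X → ℝ} {p : ℝ} {M : ℝ≥0∞} (hp : 0 < p)
    (h : eLpNorm' f p μ ≤ M) : ∫⁻ x, ‖f x‖ₑ ^ p ∂μ ≤ M ^ p := by
  rw [eLpNorm', one_div] at h
  exact (ENNReal.rpow_inv_le_iff hp).1 h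

theorem eLpNorm'_le_of_lintegral_rpow_le {f : X → ℝ} {p : ℝ} {M : ℝ≥0∞} (hp : 0 < p)
    (h : ∫⁻ x, ‖f x‖ₑ ^ p ∂μ ≤ M ^ p) : eLpNorm' f p μ ≤ M := by
  rw [eLpNorm', one_div]
  exact (ENNReal.rpow_inv_le_iff hp).2 h

theorem eLpNorm'_le_of_gNorm_lt_top {a : ℝ} {b : EReal} {ψ : ℝ → ℝ} {f : X → ℝ}
    (hψ : ∀ p ∈ expInterval a b, 0 < ψ p) (hf : gNorm μ a b ψ f < ∞) :
    ∃ C : ℝ, 0 < C ∧ ∀ p ∈ expInterval a b, eLpNorm' f p μ ≤ ENNReal.ofReal (C * ψ p) := by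
  refine ⟨(gNorm μ a b ψ f).toReal + 1, by positivity, fun p hp => ?_⟩
  have h : eLpNorm' f p μ / ENNReal.ofReal (ψ p) ≤ gNorm μ a b ψ f :=
    le_iSup₂ (f := fun p (_ : p ∈ expInterval a b) => eLpNorm' f p μ / ENNReal.ofReal (ψ p)) p hp
  have hψp := hψ p hp
  rw [ENNReal.div_le_iff (by simpa using hψp) ENNReal.ofReal_ne_top] at h
  refine h.trans ?_
  rw [ENNReal.ofReal_mul (by positivity)]
  refine mul_le_mul_left ?_ _
  rw [ENNReal.le_ofReal_iff_toReal_le hf.ne (by positivity)]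
  linarith

/-- For finite `b` a function whose rearrangement dominates `1/φ` on `(0,1)` is not in `G(ψ)`. -/
theorem gNorm_eq_top_of_tailUpTo_one_le {a b : ℝ} {ψ : ℝ → ℝ} (ha : 1 ≤ a) (hab : a < b)
    (hψ : ∀ p ∈ expInterval a b, 0 < ψ p) (hfin : gFund a b ψ 1 ≠ ∞)
    {f : X → ℝ} (hf : Measurable f)
    (hT : ∀ x, 0 < x → tailUpTo 1 a b ψ x ≤ μ {y | ENNReal.ofReal x < ‖f y‖ₑ}) :
    gNorm μ a b ψ f = ∞ := by
  by_contra hne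
  have hab' : (a : EReal) < b := EReal.coe_lt_coe_iff.2 hab
  have hb0 : 0 < b := by linarith
  obtain ⟨C, hC, hCle⟩ := eLpNorm'_le_of_gNorm_lt_top hψ (lt_top_iff_ne_top.2 hne)
  obtain ⟨K, hK, -, hKψ⟩ := gFund_finite hab' hψ one_pos hfin
  have hKψ' : ∀ p ∈ expInterval a b, 1 ≤ ψ p * K := fun p hp => by simpa using hKψ p hp
  -- If `f` were in `G(ψ)`, the `p`-th term of `φ(h)` would be at most a constant times `(b-p)^(1/p)
  -- φ(h)`. The aim is `φ(h) ≤ φ(h)/2` for one small `h`.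
  have key : ∀ h w p : ℝ, 0 < h → h ≤ 1 → p ∈ expInterval a b → 0 < w →
      gFund a b ψ h = ENNReal.ofReal w →
      h ^ (1 / p) ≤ C * 2 ^ b * (b - p) ^ (1 / p) * (ψ p * w) := by
    intro h w p hh h1 hp hw hφ
    have hpb : p < b := EReal.coe_lt_coe_iff.1 hp.2
    have hp1 : 1 < p := ha.trans_lt hp.1
    have hbp : 0 < b - p := by linarith
    have hp0 : 0 < p := by linarith
    have hψp := hψ p hp
    have hI := ((le_lintegral_rpow_mul_tailUpTo_one ha hψ hh h1 hp hw hφ).trans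
      (lintegral_rpow_mul_tail_le hf hT hp1.le)).trans
      (lintegral_rpow_le_of_eLpNorm'_le hp0 (hCle p hp))
    rw [ENNReal.ofReal_rpow_of_pos (by positivity),
      ENNReal.ofReal_le_ofReal_iff (by positivity)] at hI
    have h2 : h ≤ (C * ψ p) ^ p * (b - p) * w ^ p * (2 ^ b) ^ p := by
      have h3 : h * (2⁻¹ ^ b * w⁻¹ ^ p / (b - p)) = h / (2 ^ b * w ^ p * (b - p)) := by
        rw [Real.inv_rpow (by positivity), Real.inv_rpow hw.le]
        field_simp
      rw [h3, div_le_iff₀ (by positivity)] at hI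
      have h4 : (2 : ℝ) ^ b ≤ (2 ^ b) ^ p :=
        Real.self_le_rpow_of_one_le (Real.one_le_rpow (by norm_num) hb0.le) hp1.le
      calc h ≤ (C * ψ p) ^ p * (2 ^ b * w ^ p * (b - p)) := hI
        _ = (C * ψ p) ^ p * (b - p) * w ^ p * 2 ^ b := by ring
        _ ≤ _ := by gcongr
    calc h ^ (1 / p) ≤ ((C * ψ p) ^ p * (b - p) * w ^ p * (2 ^ b) ^ p) ^ (1 / p) := by gcongr
      _ = _ := by
        rw [Real.mul_rpow (by positivity) (by positivity),
          Real.mul_rpow (by positivity) (by positivity),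
          Real.mul_rpow (by positivity) (by positivity), one_div,
          Real.rpow_rpow_inv (by positivity) hp0.ne', Real.rpow_rpow_inv (by positivity) hp0.ne',
          Real.rpow_rpow_inv (by positivity) hp0.ne']
        ring
  -- With this `η` the terms with `p ≥ b - η` contribute at most half of `φ(h)`, for every `h ≤ 1`.
  obtain ⟨η, hη0, hη1, hηab, hηC⟩ : ∃ η : ℝ, 0 < η ∧ η ≤ 1 ∧ η < b - a ∧
      C * 2 ^ b * η ^ (1 / b) ≤ 1 / 2 := by
    have e1 : ∀ᶠ η : ℝ in 𝓝[>] 0, C * 2 ^ b * η ^ (1 / b) < 1 / 2 :=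
      (tendsto_const_mul_rpow_nhdsGT_zero _ (one_div_pos.2 hb0)).eventually_lt_const (by norm_num)
    have e2 : ∀ᶠ η : ℝ in 𝓝[>] 0, η ∈ Ioo 0 (min 1 (b - a)) :=
      Ioo_mem_nhdsGT (lt_min one_pos (by linarith))
    obtain ⟨η, h1, h2⟩ := (e1.and e2).exists
    exact ⟨η, h2.1, (h2.2.trans_le (min_le_left _ _)).le, h2.2.trans_le (min_le_right _ _), h1.le⟩
  set p₁ : ℝ := b - η with hp₁
  have hp₁mem : p₁ ∈ expInterval a b := ⟨by linarith, EReal.coe_lt_coe_iff.2 (by linarith)⟩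
  obtain ⟨p₂, hp₂mem, hp₁₂⟩ := exists_gt_mem_expInterval hp₁mem
  have hp₁0 : 0 < p₁ := by linarith [hp₁mem.1]
  have hψ₂ := hψ p₂ hp₂mem
  have hκ : 0 < 1 / p₁ - 1 / p₂ := sub_pos.2 (one_div_lt_one_div_of_lt hp₁0 hp₁₂)
  -- For `p < p₁` the term is compared with the one at `p₂ > p₁`, using `ψ ≥ 1/K`; the gain `h^(1/p₁
  -- - 1/p₂)` makes it small.
  obtain ⟨h, hh0, hh1, hhK⟩ : ∃ h : ℝ, 0 < h ∧ h ≤ 1 ∧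
      K * ψ p₂ * h ^ (1 / p₁ - 1 / p₂) ≤ 1 / 2 := by
    have e1 : ∀ᶠ h : ℝ in 𝓝[>] 0, K * ψ p₂ * h ^ (1 / p₁ - 1 / p₂) < 1 / 2 :=
      (tendsto_const_mul_rpow_nhdsGT_zero _ hκ).eventually_lt_const (by norm_num)
    have e2 : ∀ᶠ h : ℝ in 𝓝[>] 0, h ∈ Ioo (0 : ℝ) 1 := Ioo_mem_nhdsGT one_pos
    obtain ⟨h, h1, h2⟩ := (e1.and e2).exists
    exact ⟨h, h2.1, h2.2.le, h1.le⟩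
  have hφfin : gFund a b ψ h ≠ ∞ := ((gFund_mono ha hh1).trans_lt (lt_top_iff_ne_top.2 hfin)).ne
  obtain ⟨w, hw, hφ, hwψ⟩ := gFund_finite hab' hψ hh0 hφfin
  have hle : gFund a b ψ h ≤ ENNReal.ofReal (w / 2) := by
    refine gFund_le hψ hh0 fun p hp => ENNReal.ofReal_le_ofReal ?_
    have hψp := hψ p hp
    have hpb : p < b := EReal.coe_lt_coe_iff.1 hp.2
    have hp0 : 0 < p := by linarith [hp.1]
    rw [div_le_iff₀ hψp]
    rcases le_or_gt p₁ p with hle | hlt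
    · have h1 := key h w p hh0 hh1 hp hw hφ
      have hbp : 0 < b - p := by linarith
      have h2 : (b - p) ^ (1 / p) ≤ η ^ (1 / b) :=
        calc (b - p) ^ (1 / p) ≤ η ^ (1 / p) :=
              Real.rpow_le_rpow hbp.le (by linarith) (by positivity)
          _ ≤ η ^ (1 / b) := Real.rpow_le_rpow_of_exponent_ge hη0 hη1
              (one_div_le_one_div_of_le hp0 hpb.le)
      calc h ^ (1 / p) ≤ C * 2 ^ b * (b - p) ^ (1 / p) * (ψ p * w) := h1
        _ ≤ C * 2 ^ b * η ^ (1 / b) * (ψ p * w) := by gcongr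
        _ ≤ 1 / 2 * (ψ p * w) := by gcongr
        _ = _ := by ring
    · have h1 : h ^ (1 / p) ≤ h ^ (1 / p₁) :=
        Real.rpow_le_rpow_of_exponent_ge hh0 hh1 (one_div_le_one_div_of_le hp0 hlt.le)
      have h2 : h ^ (1 / p₁) = h ^ (1 / p₁ - 1 / p₂) * h ^ (1 / p₂) := by
        rw [← Real.rpow_add hh0]; ring_nf
      have h3 := hwψ p₂ hp₂mem
      calc h ^ (1 / p) ≤ h ^ (1 / p₁ - 1 / p₂) * h ^ (1 / p₂) := h1.trans h2.le
        _ ≤ h ^ (1 / p₁ - 1 / p₂) * (ψ p₂ * w) := by gcongr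
        _ ≤ (ψ p * K) * (h ^ (1 / p₁ - 1 / p₂) * (ψ p₂ * w)) :=
            le_mul_of_one_le_left (by positivity) (hKψ' p hp)
        _ = (K * ψ p₂ * h ^ (1 / p₁ - 1 / p₂)) * (ψ p * w) := by ring
        _ ≤ 1 / 2 * (ψ p * w) := by gcongr
        _ = _ := by ring
  rw [hφ, ENNReal.ofReal_le_ofReal_iff (by positivity)] at hle
  linarith

theorem not_equivSpaces_marcIntNorm [SigmaFinite μ] (hd : IsDiffuse μ) (hμ : 1 ≤ μ univ)
    {a : ℝ} {b : EReal} {ψ : ℝ → ℝ} (ha : 1 ≤ a)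
    (hab : (a : EReal) < b) (hψ : ∀ p ∈ expInterval a b, 0 < ψ p)
    (hdiv : (⨆ p ∈ expInterval a b,
        (∫⁻ x in Ioi (0 : ℝ), ENNReal.ofReal x ^ (p - 1) * gTail μ a b ψ x) ^ (1 / p) /
          ENNReal.ofReal (ψ p)) = ∞)
    (hcases : 1 < a ∨ b < ⊤ ∨ μ univ = 1)
    {θ : ℝ → ℝ} (hθ : IsQuasiConcave θ) : ¬ EquivSpaces (gNorm μ a b ψ) (marcIntNorm μ θ) := by
  intro heq
  obtain ⟨C, hC, hCle⟩ := heq.exists_pos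
  have hfin : ∀ h : ℝ, 0 < h → ENNReal.ofReal h ≤ μ univ → gFund a b ψ h ≠ ∞ ∧
      ENNReal.ofReal (h / θ h) ≤ ENNReal.ofReal C * gFund a b ψ h := by
    intro h hh hm
    obtain ⟨A, -, hA, hAh⟩ := hd.exists_subset MeasurableSet.univ hm
    have h1 := hCle _ ((measurable_const (a := (1 : ℝ))).indicator hA)
    rw [gNorm_indicator ha hA hAh] at h1
    exact ⟨(h1.1.trans_lt (ENNReal.mul_lt_top ENNReal.ofReal_lt_top
      (marcIntNorm_indicator_lt_top hθ hh hAh))).ne, (le_marcIntNorm_indicator hθ hh hAh).trans h1.2⟩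
  have hfin1 : gFund a b ψ 1 ≠ ∞ := (hfin 1 one_pos (by simpa using hμ)).1
  -- Power growth on `(0,m]` puts the extremal function cut at measure `m` into `G(ψ)`; each case
  -- then contradicts this, with `m = μ(X)` or `m = 1`.
  have main : ∀ m : ℝ≥0∞, 0 < m → m ≤ μ univ → ∀ q A : ℝ, 1 < q → 0 < A →
      (∀ s h : ℝ, 0 < s → s ≤ h → ENNReal.ofReal h ≤ m →
        gFund a b ψ h ≤ ENNReal.ofReal (A * (h / s) ^ (1 / q)) * gFund a b ψ s) →
      ∃ f : X → ℝ, Measurable f ∧ gNorm μ a b ψ f ≠ ∞ ∧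
        ∀ x, 0 < x → tailUpTo m a b ψ x ≤ μ {y | ENNReal.ofReal x < ‖f y‖ₑ} := by
    intro m hm hmμ q A hq hA hgrow
    obtain ⟨f, hf, hfT⟩ := hd.exists_tailUpTo hmμ ha hab hψ
    refine ⟨f, hf, ((heq.1 f hf).2 ?_).ne, fun x hx => (hfT x hx).1⟩
    exact marcIntNorm_lt_top_of_growth hm ha hab hψ hq hA hC
      (fun h hh hhm => (hfin h hh (hhm.trans hmμ)).1) hgrow hθ
      (fun h hh hhm => (hfin h hh (hhm.trans hmμ)).2) fun x hx => (hfT x hx).2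
  have main1 : ∃ f : X → ℝ, Measurable f ∧ gNorm μ a b ψ f ≠ ∞ ∧
      ∀ x, 0 < x → tailUpTo 1 a b ψ x ≤ μ {y | ENNReal.ofReal x < ‖f y‖ₑ} := by
    obtain ⟨q, A, hq, hA, hgrow⟩ := exists_gFund_growth_of_le_one ha hab hψ hfin1
    exact main 1 one_pos hμ q A hq hA fun s h hs hsh h1 => hgrow s h hs hsh (by simpa using h1)
  have hlarge : ∀ f : X → ℝ, Measurable f →
      (∀ x, 0 < x → tailUpTo (μ univ) a b ψ x ≤ μ {y | ENNReal.ofReal x < ‖f y‖ₑ}) →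
      gNorm μ a b ψ f = ∞ := fun f hf hT =>
    top_le_iff.1 (hdiv.symm.le.trans (rpow_lintegral_tail_div_le_gNorm hf hT ha))
  rcases hcases with h | h | h
  · obtain ⟨f, hf, hne, hT⟩ := main (μ univ) (one_pos.trans_le hμ) le_rfl a 1 h one_pos
      fun s h hs hsh _ => by rw [one_mul]; exact gFund_growth ha hψ hs hsh
    exact hne (hlarge f hf hT)
  · obtain ⟨f, hf, hne, hT⟩ := main1
    lift b to ℝ using ⟨h.ne, (bot_le.trans_lt hab).ne'⟩
    exact hne (gNorm_eq_top_of_tailUpTo_one_le ha (EReal.coe_lt_coe_iff.1 hab) hψ hfin1 hf hT)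
  · obtain ⟨f, hf, hne, hT⟩ := main1
    exact hne (hlarge f hf (by rwa [h]))

end

/-! ### Lorentz spaces. -/

section

variable {X : Type*} [MeasurableSpace X] {μ : Measure X}

theorem lorentzNorm_indicator {χ : ℝ → ℝ} (hχ : Monotone χ) {A : Set X} {δ : ℝ}
    (hA : μ A = ENNReal.ofReal δ) :
    lorentzNorm μ χ hχ (A.indicator fun _ => (1 : ℝ)) =
      hχ.stieltjesFunction.measure (Ico 0 δ) := by
  rw [lorentzNorm, setLIntegral_congr_fun (g := (Iio δ).indicator 1) measurableSet_Ici,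
    lintegral_indicator_one measurableSet_Iio, Measure.restrict_apply measurableSet_Iio,
    inter_comm, Ici_inter_Iio]
  intro t ht
  rcases lt_or_ge t δ with hlt | hge
  · simp only [rearr_indicator_of_lt hA ht hlt]; simp [hlt]
  · simp only [rearr_indicator_of_le hA hge]; simp [hge]

theorem iSup_rpow_le_tsum {ι : Type*} (u : ι → ℝ≥0∞) {p : ℝ} (hp : 0 < p) :
    (⨆ i, u i) ^ p ≤ ∑' i, u i ^ p := by
  rw [← ENNReal.le_rpow_inv_iff hp]
  exact iSup_le fun i => (ENNReal.le_rpow_inv_iff hp).2 (ENNReal.le_tsum i)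

theorem lintegral_iSup_indicator_rpow_le {ι : Type*} [Countable ι] {A : ι → Set X}
    (hA : ∀ i, MeasurableSet (A i)) (c : ι → ℝ≥0∞) {p : ℝ} (hp : 0 < p) :
    ∫⁻ x, (⨆ i, (A i).indicator (fun _ => c i) x) ^ p ∂μ ≤ ∑' i, c i ^ p * μ (A i) := by
  calc _ ≤ ∫⁻ x, ∑' i, (A i).indicator (fun _ => c i ^ p) x ∂μ := lintegral_mono fun x => by
        refine (iSup_rpow_le_tsum _ hp).trans_eq (tsum_congr fun i => ?_)
        by_cases hx : x ∈ A i <;> simp [hx, hp]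
    _ = _ := by
        rw [lintegral_tsum fun i => (measurable_const.indicator (hA i)).aemeasurable]
        exact tsum_congr fun i => lintegral_indicator_const (hA i) _

theorem tsum_ofReal_one_div_add_one_mul {c : ℝ} (hc : 0 < c) :
    ∑' k : ℕ, ENNReal.ofReal (1 / (k + 1) * c) = ∞ := by
  by_contra h
  have h1 := ENNReal.summable_toReal h
  have h2 : ∀ k : ℕ, (ENNReal.ofReal (1 / (k + 1) * c)).toReal = 1 / (k + 1) * c := fun k =>
    ENNReal.toReal_ofReal (by positivity)
  simp only [h2] at h1
  rw [summable_mul_right_iff hc.ne'] at h1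
  refine Real.not_summable_one_div_natCast ((summable_nat_add_iff 1).1 ?_)
  simpa using h1

/-- A set function comparable to the fundamental function decays along a rapidly decreasing
sequence, which may be chosen so that normalized indicators are small in `L^p`, `p ≤ p₀`. -/
theorem exists_lacunary_seq {a b : ℝ} {ψ : ℝ → ℝ} (ha : 1 ≤ a) (hab : a < b)
    (hψ : ∀ p ∈ expInterval a b, 0 < ψ p) {M : ℝ → ℝ≥0∞} {C : ℝ} (hC : 0 < C)
    (hfin : gFund a b ψ 1 ≠ ∞)
    (hM : ∀ δ, 0 < δ → δ ≤ 1 → M δ ≤ ENNReal.ofReal C * gFund a b ψ δ)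
    (hM0 : ∀ δ, 0 < δ → δ ≤ 1 → 0 < M δ) (D : ℝ) {κ : ℝ} (hκ : 0 < κ) :
    ∃ δ : ℕ → ℝ, ∀ k, (0 < δ k ∧ δ k ≤ 1 ∧ D * δ k ^ κ ≤ 2⁻¹ ^ k) ∧
      δ (k + 1) < δ k ∧ M (δ (k + 1)) ≤ M (δ k) / 2 := by
  have hab' : (a : EReal) < b := EReal.coe_lt_coe_iff.2 hab
  have hb0 : 0 < b := by linarith
  obtain ⟨K, hK, hφK, -⟩ := gFund_finite hab' hψ one_pos hfin
  have hpow : ∀ k : ℕ, ∀ᶠ δ : ℝ in 𝓝[>] 0, D * δ ^ κ ≤ 2⁻¹ ^ k := fun k =>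
    ((tendsto_const_mul_rpow_nhdsGT_zero D hκ).eventually_lt_const (by positivity)).mono
      fun _ h => h.le
  have hIoo : ∀ c : ℝ, 0 < c → ∀ᶠ δ : ℝ in 𝓝[>] 0, δ ∈ Ioo 0 c := fun c hc => Ioo_mem_nhdsGT hc
  -- Finite `b` enters here: `φ(δ) ≤ δ^(1/b) φ(1)` for `δ ≤ 1`, so `M` tends to zero.
  have hMlim : ∀ ε : ℝ≥0∞, 0 < ε → ∀ᶠ δ : ℝ in 𝓝[>] 0, M δ ≤ ε := by
    intro ε hε
    have h1 := ENNReal.tendsto_ofReal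
      (tendsto_const_mul_rpow_nhdsGT_zero (C * K) (one_div_pos.2 hb0))
    rw [ENNReal.ofReal_zero] at h1
    filter_upwards [h1.eventually_lt_const hε, hIoo 1 one_pos] with δ h2 h3
    refine le_trans ((hM δ h3.1 h3.2.le).trans ?_) h2.le
    have h4 : gFund a b ψ δ ≤ ENNReal.ofReal (δ ^ (1 / b)) * gFund a b ψ 1 := by
      refine gFund_le_mul hψ h3.1 one_pos (Real.rpow_nonneg h3.1.le _) fun p hp => ?_
      rw [Real.one_rpow, mul_one]
      exact Real.rpow_le_rpow_of_exponent_ge h3.1 h3.2.le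
        (one_div_le_one_div_of_le (by linarith [hp.1]) (EReal.coe_lt_coe_iff.1 hp.2).le)
    calc ENNReal.ofReal C * gFund a b ψ δ
        ≤ ENNReal.ofReal C * (ENNReal.ofReal (δ ^ (1 / b)) * gFund a b ψ 1) :=
          mul_le_mul_right h4 _
      _ = _ := by
          rw [hφK, ← ENNReal.ofReal_mul (Real.rpow_nonneg h3.1.le _), ← ENNReal.ofReal_mul hC.le]
          ring_nf
  refine exists_seq_of_step (P := fun k δ => 0 < δ ∧ δ ≤ 1 ∧ D * δ ^ κ ≤ 2⁻¹ ^ k)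
    (R := fun _ δ δ' => δ' < δ ∧ M δ' ≤ M δ / 2) ?_ ?_
  · obtain ⟨δ, h1, h2⟩ := ((hIoo 1 one_pos).and (hpow 0)).exists
    exact ⟨δ, h1.1, h1.2.le, h2⟩
  · rintro k δ ⟨h0, h1, -⟩
    obtain ⟨δ', ⟨h2, h3⟩, h4⟩ := (((hIoo δ h0).and (hpow (k + 1))).and
      (hMlim (M δ / 2) (ENNReal.half_pos (hM0 δ h0 h1).ne'))).exists
    exact ⟨δ', ⟨h2.1, h2.2.le.trans h1, h3⟩, h2.2, h4⟩

/-- Halving leaves at least half the mass of `[0, δ_k)` on the shell `[δ_{k+1}, δ_k)`. The shells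
are disjoint, so their contributions add. -/
theorem le_lintegral_of_lacunary {ν : Measure ℝ} {δ : ℕ → ℝ} (hδ0 : ∀ k, 0 < δ k)
    (hδ : ∀ k, δ (k + 1) < δ k) (hfin : ∀ k, ν (Ico 0 (δ k)) ≠ ∞)
    (hhalf : ∀ k, ν (Ico 0 (δ (k + 1))) ≤ ν (Ico 0 (δ k)) / 2) {F : ℝ → ℝ≥0∞} {c : ℕ → ℝ≥0∞}
    (hF : ∀ k t, 0 ≤ t → t < δ k → c k ≤ F t) :
    ∑' k, c k * (ν (Ico 0 (δ k)) / 2) ≤ ∫⁻ t in Ici 0, F t ∂ν := by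
  have hanti : StrictAnti δ := strictAnti_nat_of_succ_lt hδ
  have hdisj : Pairwise (Function.onFun Disjoint fun k => Ico (δ (k + 1)) (δ k)) := by
    refine (pairwise_disjoint_on _).2 fun i j hij => disjoint_left.2 fun t h1 h2 => ?_
    exact (h2.2.trans_le ((hanti.antitone (Nat.succ_le_of_lt hij)).trans h1.1)).false
  calc ∑' k, c k * (ν (Ico 0 (δ k)) / 2)
      ≤ ∑' k, ∫⁻ t in Ico (δ (k + 1)) (δ k), F t ∂ν := ENNReal.tsum_le_tsum fun k => by
        have h1 : ν (Ico 0 (δ k)) / 2 ≤ ν (Ico (δ (k + 1)) (δ k)) := by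
          have h2 : ν (Ico 0 (δ k)) ≤ ν (Ico 0 (δ (k + 1))) + ν (Ico (δ (k + 1)) (δ k)) := by
            rw [← Ico_union_Ico_eq_Ico (hδ0 (k + 1)).le (hδ k).le]
            exact measure_union_le _ _
          have h3 := h2.trans (add_le_add_left (hhalf k) _)
          nth_rw 1 [← ENNReal.add_halves (ν (Ico 0 (δ k)))] at h3
          exact (ENNReal.add_le_add_iff_left (ENNReal.div_ne_top (hfin k) two_ne_zero)).1 h3
        calc _ ≤ c k * ν (Ico (δ (k + 1)) (δ k)) := mul_le_mul_right h1 _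
          _ = ∫⁻ _ in Ico (δ (k + 1)) (δ k), c k ∂ν := by rw [setLIntegral_const]
          _ ≤ _ := setLIntegral_mono' measurableSet_Ico fun t ht =>
              hF k t ((hδ0 _).le.trans ht.1) ht.2
    _ = ∫⁻ t in ⋃ k, Ico (δ (k + 1)) (δ k), F t ∂ν :=
        (lintegral_iUnion (fun _ => measurableSet_Ico) hdisj _).symm
    _ ≤ _ := lintegral_mono_set (iUnion_subset fun k t ht => (hδ0 _).le.trans ht.1)

theorem not_equivSpaces_lorentzNorm [SigmaFinite μ] (hd : IsDiffuse μ) (hμ : 1 ≤ μ univ)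
    {a b : ℝ} {ψ : ℝ → ℝ} (ha : 1 ≤ a) (hab : a < b) (hψ : ∀ p ∈ expInterval a b, 0 < ψ p)
    {χ : ℝ → ℝ} (hχ : Monotone χ) : ¬ EquivSpaces (gNorm μ a b ψ) (lorentzNorm μ χ hχ) := by
  intro heq
  obtain ⟨C, hC, hCle⟩ := heq.exists_pos
  have hab' : (a : EReal) < b := EReal.coe_lt_coe_iff.2 hab
  set ν := hχ.stieltjesFunction.measure with hν
  have hνfin : ∀ δ : ℝ, ν (Ico 0 δ) ≠ ∞ := fun δ => measure_Ico_lt_top.ne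
  have hset : ∀ δ : ℝ, δ ≤ 1 → ∃ A : Set X, MeasurableSet A ∧ μ A = ENNReal.ofReal δ := by
    intro δ h1
    obtain ⟨A, -, hA, hAδ⟩ := hd.exists_subset MeasurableSet.univ
      (le_trans (by simpa using h1) hμ : ENNReal.ofReal δ ≤ μ univ)
    exact ⟨A, hA, hAδ⟩
  have hcomp : ∀ δ : ℝ, δ ≤ 1 → gFund a b ψ δ ≤ ENNReal.ofReal C * ν (Ico 0 δ) ∧
      ν (Ico 0 δ) ≤ ENNReal.ofReal C * gFund a b ψ δ := by
    intro δ h1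
    obtain ⟨A, hA, hAδ⟩ := hset δ h1
    have h := hCle _ ((measurable_const (a := (1 : ℝ))).indicator hA)
    rwa [gNorm_indicator ha hA hAδ, lorentzNorm_indicator hχ hAδ] at h
  have hfin : ∀ δ : ℝ, δ ≤ 1 → gFund a b ψ δ ≠ ∞ := fun δ h1 =>
    ((hcomp δ h1).1.trans_lt (ENNReal.mul_lt_top ENNReal.ofReal_lt_top (hνfin δ).lt_top)).ne
  obtain ⟨K, hK, -, hKψ⟩ := gFund_finite hab' hψ one_pos (hfin 1 le_rfl)
  obtain ⟨p₀, hp₀⟩ := exists_mem_expInterval hab'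
  obtain ⟨p₁, hp₁, hp₀₁⟩ := exists_gt_mem_expInterval hp₀
  have hp₀1 : 1 < p₀ := ha.trans_lt hp₀.1
  have hκ : 0 < 1 / p₀ - 1 / p₁ := sub_pos.2 (one_div_lt_one_div_of_lt (by linarith) hp₀₁)
  have hψ₁ := hψ p₁ hp₁
  obtain ⟨δ, hδ⟩ := exists_lacunary_seq ha hab hψ hC (hfin 1 le_rfl)
    (fun δ _ h1 => (hcomp δ h1).2) (fun δ h0 h1 => pos_iff_ne_zero.2 fun hz => by
      have := (hcomp δ h1).1
      rw [hz, mul_zero] at this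
      exact (gFund_pos hab' hψ h0).not_ge this) (K * ψ p₁) hκ
  have hδ0 : ∀ k, 0 < δ k := fun k => (hδ k).1.1
  have hδ1 : ∀ k, δ k ≤ 1 := fun k => (hδ k).1.2.1
  choose w hw0 hφw hwψ using fun k => gFund_finite hab' hψ (hδ0 k) (hfin _ (hδ1 k))
  choose A hA hAδ using fun k => hset (δ k) (hδ1 k)
  -- Not summable, but its `p₀`-th powers are, since `p₀ > 1`.
  let α : ℕ → ℝ := fun k => 1 / (k + 1)
  have hα0 : ∀ k, 0 < α k := fun k => by positivity
  have hα1 : ∀ k, α k ≤ 1 := fun k => by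
    rw [div_le_one (by positivity)]; simp
  let c : ℕ → ℝ := fun k => α k / w k
  have hc0 : ∀ k, 0 < c k := fun k => div_pos (hα0 k) (hw0 k)
  let F : X → ℝ≥0∞ := fun x => ⨆ k, (A k).indicator (fun _ => ENNReal.ofReal (c k)) x
  have hF : Measurable F := .iSup fun k => measurable_const.indicator (hA k)
  let β : ℕ → ℝ := fun k => α k ^ p₀ + 2⁻¹ ^ k
  have hβ0 : ∀ k, 0 ≤ β k := fun k => by have := hα0 k; positivity
  have hβ : Summable β := by
    refine Summable.add ?_ (summable_geometric_of_lt_one (by norm_num) (by norm_num))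
    have := (summable_nat_add_iff 1).2 (Real.summable_one_div_nat_rpow.2 hp₀1)
    refine this.congr fun k => ?_
    simp only [α]
    rw [Real.div_rpow zero_le_one (by positivity), Real.one_rpow]
    push_cast
    rfl
  have hterm : ∀ p ∈ expInterval a b, ∀ k, c k ^ p * δ k ≤ ψ p ^ p * β k := by
    intro p hp k
    have hψp := hψ p hp
    have hp1 : 1 < p := ha.trans_lt hp.1
    have hp0 : 0 < p := by linarith
    have hδk := hδ0 k
    have hwk := hw0 k
    have hαk := hα0 k
    -- The ratio of the `p`-th term to the supremum `φ(δ_k)`, hence at most `1`. For `p ≥ p₀` this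
    -- bound and the powers of `α` suffice; for `p < p₀` the choice of `δ_k` makes `u ≤ 2^(-k)`.
    set u : ℝ := δ k ^ (1 / p) / (ψ p * w k) with hu
    have hu0 : 0 < u := by positivity
    have hu1 : u ≤ 1 := (div_le_one (by positivity)).2 (hwψ k p hp)
    have hcu : c k ^ p * δ k = ψ p ^ p * (α k * u) ^ p := by
      have h1 : δ k = (δ k ^ (1 / p)) ^ p := by
        rw [← Real.rpow_mul hδk.le, one_div_mul_cancel hp0.ne', Real.rpow_one]
      nth_rw 1 [h1]
      rw [← Real.mul_rpow (hc0 k).le (by positivity), ← Real.mul_rpow hψp.le (by positivity)]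
      congr 1
      simp only [c, hu]
      field_simp
    rw [hcu]
    refine mul_le_mul_of_nonneg_left ?_ (by positivity)
    rcases le_or_gt p₀ p with hle | hlt
    · calc (α k * u) ^ p ≤ α k ^ p :=
            Real.rpow_le_rpow (by positivity) (mul_le_of_le_one_right hαk.le hu1) hp0.le
        _ ≤ α k ^ p₀ := Real.rpow_le_rpow_of_exponent_ge hαk (hα1 k) hle
        _ ≤ β k := le_add_of_nonneg_right (by positivity)
    · have hsmall : u ≤ K * ψ p₁ * δ k ^ (1 / p₀ - 1 / p₁) := by
        rw [hu, div_le_iff₀ (by positivity)]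
        calc δ k ^ (1 / p) ≤ δ k ^ (1 / p₀) :=
              Real.rpow_le_rpow_of_exponent_ge hδk (hδ1 k) (one_div_le_one_div_of_le hp0 hlt.le)
          _ = δ k ^ (1 / p₀ - 1 / p₁) * δ k ^ (1 / p₁) := by
              rw [← Real.rpow_add hδk, sub_add_cancel]
          _ ≤ δ k ^ (1 / p₀ - 1 / p₁) * (ψ p₁ * w k) := by gcongr; exact hwψ k p₁ hp₁
          _ ≤ (ψ p * K) * (δ k ^ (1 / p₀ - 1 / p₁) * (ψ p₁ * w k)) :=
              le_mul_of_one_le_left (by positivity) (by simpa using hKψ p hp)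
          _ = _ := by ring
      have h1 : α k * u ≤ 1 := mul_le_one₀ (hα1 k) hu0.le hu1
      calc (α k * u) ^ p ≤ (α k * u) ^ (1 : ℝ) :=
            Real.rpow_le_rpow_of_exponent_ge (by positivity) h1 hp1.le
        _ ≤ u := by rw [Real.rpow_one]; exact mul_le_of_le_one_left hu0.le (hα1 k)
        _ ≤ 2⁻¹ ^ k := hsmall.trans (hδ k).1.2.2
        _ ≤ β k := le_add_of_nonneg_left (by positivity)
  -- The summand `1` ensures `B ≤ B^p`, so a single constant serves all `p`.
  set B : ℝ := 1 + ∑' k, β k with hB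
  have hB1 : 1 ≤ B := le_add_of_nonneg_right (tsum_nonneg hβ0)
  have hmom : ∀ p ∈ expInterval a b, ∫⁻ x, F x ^ p ∂μ ≤ ENNReal.ofReal (B * ψ p) ^ p := by
    intro p hp
    have hψp := hψ p hp
    have hp1 : 1 < p := ha.trans_lt hp.1
    have hp0 : 0 < p := by linarith
    calc ∫⁻ x, F x ^ p ∂μ ≤ ∑' k, ENNReal.ofReal (c k) ^ p * μ (A k) :=
          lintegral_iSup_indicator_rpow_le hA _ hp0
      _ ≤ ∑' k, ENNReal.ofReal (ψ p ^ p * β k) := ENNReal.tsum_le_tsum fun k => by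
          have := hc0 k
          rw [hAδ, ENNReal.ofReal_rpow_of_pos (hc0 k), ← ENNReal.ofReal_mul (by positivity)]
          exact ENNReal.ofReal_le_ofReal (hterm p hp k)
      _ = ENNReal.ofReal (ψ p ^ p * ∑' k, β k) := by
          rw [← tsum_mul_left, ENNReal.ofReal_tsum_of_nonneg
            (fun k => mul_nonneg (by positivity) (hβ0 k)) (hβ.mul_left _)]
      _ ≤ ENNReal.ofReal ((B * ψ p) ^ p) := by
          refine ENNReal.ofReal_le_ofReal ?_
          rw [Real.mul_rpow (by positivity) hψp.le, mul_comm]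
          gcongr
          calc ∑' k, β k ≤ B := by rw [hB]; linarith
            _ ≤ B ^ p := Real.self_le_rpow_of_one_le hB1 hp1.le
      _ = _ := (ENNReal.ofReal_rpow_of_pos (by positivity)).symm
  have hae : ∀ᵐ x ∂μ, F x ≠ ∞ := by
    have h1 : ∫⁻ x, F x ^ p₀ ∂μ ≠ ∞ := ((hmom p₀ hp₀).trans_lt
      (ENNReal.rpow_lt_top_of_nonneg (by linarith) ENNReal.ofReal_ne_top)).ne
    filter_upwards [ae_lt_top (hF.pow_const p₀) h1] with x hx hFx
    rw [hFx, ENNReal.top_rpow_of_pos (by linarith)] at hx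
    exact hx.false
  have hf : Measurable fun x => (F x).toReal := hF.ennreal_toReal
  have henorm : ∀ x, ‖(F x).toReal‖ₑ = ENNReal.ofReal (F x).toReal := fun x =>
    Real.enorm_eq_ofReal ENNReal.toReal_nonneg
  have hG : gNorm μ a b ψ (fun x => (F x).toReal) < ∞ := by
    refine lt_of_le_of_lt (iSup₂_le fun p hp => ?_) (ENNReal.ofReal_lt_top (r := B))
    have hp0 : 0 < p := by linarith [hp.1]
    refine ENNReal.div_le_of_le_mul ?_
    rw [← ENNReal.ofReal_mul (by linarith)]
    refine eLpNorm'_le_of_lintegral_rpow_le hp0 (le_trans (lintegral_mono fun x => ?_) (hmom p hp))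
    rw [henorm]
    exact ENNReal.rpow_le_rpow ENNReal.ofReal_toReal_le hp0.le
  refine ((heq.1 _ hf).1 hG).ne (top_le_iff.1 ?_)
  calc ∞ = ∑' k : ℕ, ENNReal.ofReal (1 / (k + 1) * (2 * C)⁻¹) :=
        (tsum_ofReal_one_div_add_one_mul (by positivity)).symm
    _ ≤ ∑' k, ENNReal.ofReal (c k) * (ν (Ico 0 (δ k)) / 2) := ENNReal.tsum_le_tsum fun k => by
        have hwk := hw0 k
        have h1 := (hcomp (δ k) (hδ1 k)).1
        rw [hφw k] at h1
        have h2 : ENNReal.ofReal (w k * (2 * C)⁻¹) ≤ ν (Ico 0 (δ k)) / 2 := by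
          rw [ENNReal.le_div_iff_mul_le (Or.inl two_ne_zero) (Or.inl ENNReal.ofNat_ne_top),
            show (2 : ℝ≥0∞) = ENNReal.ofReal 2 by simp, ← ENNReal.ofReal_mul (by positivity)]
          have h3 : w k * (2 * C)⁻¹ * 2 = C⁻¹ * w k := by field_simp
          rw [h3, ENNReal.ofReal_mul (by positivity), ENNReal.ofReal_inv_of_pos hC,
            mul_comm, ← div_eq_mul_inv]
          exact ENNReal.div_le_of_le_mul' h1
        refine le_trans (le_of_eq ?_) (mul_le_mul_right h2 _)
        rw [← ENNReal.ofReal_mul (hc0 k).le]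
        congr 1
        simp only [c, α]
        field_simp
    _ ≤ _ := le_lintegral_of_lacunary hδ0 (fun k => (hδ k).2.1) (fun k => hνfin _)
        (fun k => (hδ k).2.2) fun k t ht htδ => by
          refine le_rearr_of_ae (A := A k) ?_ ?_
          · rw [hAδ]; exact (ENNReal.ofReal_lt_ofReal_iff (hδ0 k)).2 htδ
          · filter_upwards [hae] with x hx hxA
            rw [henorm, ENNReal.ofReal_toReal hx]
            refine le_trans (le_of_eq ?_)
              (le_iSup (fun k => (A k).indicator (fun _ => ENNReal.ofReal (c k)) x) k)
            rw [indicator_of_mem hxA]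

end

theorem theorem2 {X : Type*} [MeasurableSpace X] (μ : Measure X) [SigmaFinite μ]
    (hdiff : IsDiffuse μ) (hμ : μ univ = 1 ∨ μ univ = ∞) :
    -- A: Orlicz spaces
    (∀ (a : ℝ) (b : EReal) (ψ : ℝ → ℝ) (g : X → ℝ), 1 ≤ a → (a : EReal) < b →
      ψ ∈ EXPsiClass μ a b → Measurable g → ComparableToMoments μ a b ψ g →
      (∀ ε : ℝ≥0, 0 < ε → ∫⁻ x, gOrliczFun a b ψ (ε * ‖g x‖₊) ∂μ = ∞) →
      ∀ Φ : ℝ≥0 → ℝ≥0∞, IsOrliczFun Φ →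
        ¬ EquivSpaces (gNorm μ a b ψ) (orliczNorm μ Φ)) ∧
    -- B: Marcinkiewicz spaces
    (∀ (a : ℝ) (b : EReal) (ψ : ℝ → ℝ), 1 ≤ a → (a : EReal) < b →
      ψ ∈ UPsiClass a b ∪ EXPsiClass μ a b →
      (⨆ p ∈ expInterval a b,
        (∫⁻ x in Ioi (0 : ℝ), ENNReal.ofReal x ^ (p - 1) * gTail μ a b ψ x) ^ (1 / p) /
          ENNReal.ofReal (ψ p)) = ∞ →
      (∀ θ : ℝ → ℝ, (∀ δ, 0 < δ → 0 < θ δ) →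
        ¬ EquivSpaces (gNorm μ a b ψ) (marcNorm μ θ)) ∧
      (1 < a ∨ b < ⊤ ∨ μ univ = 1 → ∀ θ : ℝ → ℝ, IsQuasiConcave θ →
        ¬ EquivSpaces (gNorm μ a b ψ) (marcIntNorm μ θ))) ∧
    -- C: Lorentz spaces
    (∀ (a b : ℝ) (ψ : ℝ → ℝ), 1 ≤ a → a < b → ψ ∈ UPsiClass a b →
      (Tendsto ψ (𝓝[>] a) atTop ∨ Tendsto ψ (𝓝[<] b) atTop) →
      ∀ (χ : ℝ → ℝ) (hχ : IsQuasiConcave χ),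
        ¬ EquivSpaces (gNorm μ a b ψ) (lorentzNorm μ χ hχ.mono)) := by
  have hμ1 : 1 ≤ μ univ := by rcases hμ with h | h <;> simp [h]
  have hpos : ∀ {a : ℝ} {b : EReal} {ψ : ℝ → ℝ}, ψ ∈ UPsiClass a b ∪ EXPsiClass μ a b →
      ∀ p ∈ expInterval a b, 0 < ψ p := by
    rintro a b ψ (h | ⟨ψ₀, h₀, c, C, hc, -, h⟩) p hp
    · exact h.1 p hp
    · exact (mul_pos hc (h₀.1 p hp)).trans_le (h p hp).1
  refine ⟨fun a b ψ g ha _ _ hg hcomp hdiv Φ hΦ =>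
    not_equivSpaces_orliczNorm hdiff ha hg hcomp hdiv hΦ, fun a b ψ ha hab hψ hdiv =>
    ⟨fun θ hθ => not_equivSpaces_marcNorm hdiff ha hab (hpos hψ) hdiv hθ, fun hcases θ hθ =>
    not_equivSpaces_marcIntNorm hdiff hμ1 ha hab (hpos hψ) hdiv hcases hθ⟩,
    fun a b ψ ha hab hψ _ χ hχ => not_equivSpaces_lorentzNorm hdiff hμ1 ha hab hψ.1 hχ.mono⟩
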